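/- Let $(R,\mathfrak m)$ be a (Noetherian) Cohen–Macaulay local ring of dimension $d\ge 1$, and write $\ell$ for length. Let $I_1,I_2$ be $\mathfrak m$-primary ideals. Let $x_1,\dots,x_d\in I_2$ be a superficial sequence for $I_2$ and $I_1$ such that $(\mathbf x_d)=(x_1,\dots,x_d)$ is a minimal reduction of $I_2$. Here $x\in I_2$ is *superficial* for $I_2$ and $I_1$ if there is $r_0>0$ with $xR\cap I_1^sI_2^r=xI_1^sI_2^{r-1}$ for all $r\ge r_0$, $s\ge 0$; and $x_1,\dots,x_d$ is a *superficial sequence* if, for each $i$, the image of $x_i$ in $R/(x_1,\dots,x_{i-1})$ is superficial for the images of $I_2$ and $I_1$. For $n\in\mathbb Z$ (with $I_2^m=R$ for $m\le 0$) let $C(\mathbf x_d,(1,n))$ be the complex $$0\to \frac{R}{I_1I_2^{n-d}}\to\cdots\to\Big(\frac{R}{I_1I_2^{n-j}}\Big)^{\binom dj}\to\cdots\to\Big(\frac{R}{I_1I_2^{n-1}}\Big)^{\binom d1}\to\frac{R}{I_1I_2^{n}}\to 0$$ with maps induced by the Koszul complex $K_\bullet(x_1,\dots,x_d;R)$, and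 put $h_j(C,\mathbf x_d)(1,n)=\ell\big(H_j(C(\mathbf x_d,(1,n)))\big)$. Let $g_{0},\dots,g_{d}$, $g_i=g_{i,I_1}(I_2)$, be the integers, uniquely determined, such that $$\ell(R/I_1I_2^n)=\sum_{j=0}^d(-1)^j g_{j}\binom{n+d-j-1}{d-j}\qquad\text{for all } n\gg 0 .$$ Then all the lengths that occur here are finite, $g_0=e(I_2)$, where $e(I_2)=\lim_{n\to\infty} d!\,\ell(R/I_2^n)/n^d$ is the multiplicity of $I_2$, and for $1\le i\le d$ $$g_i=\sum_{n\ge i-1}\binom{n}{i-1}\Big[\ell\Big(\frac{I_1I_2^{n+1}+(\mathbf x_d)}{(\mathbf x_d)}\Big)-\sum_{j\ge 1}(-1)^jh_j(C,\mathbf x_d)(1,n+1)\Big]+(-1)^d\,\ell(R/K_i)$$ $$\phantom{g_i}=\sum_{n\ge i-1}\binom{n}{i-1}\Big[\ell\Big(\frac{I_1I_2^{n+1}}{(\mathbf x_d)I_1I_2^{n}}\Big)-\sum_{j\ge 2}(-1)^jh_j(C,\mathbf x_d)(1,n+1)\Big]+(-1)^d\,\ell(R/K_i),$$ where $K_i=R$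 for $i<d$ and $K_d=I_1$; in both sums over $n$ only finitely many terms are nonzero. -/

import Mathlib

open Filter Topology IsLocalRing

noncomputable section

namespace FiberCone

/-- A Noetherian local ring is Cohen-Macaulay if its maximal ideal contains a regular sequence
whose length is the Krull dimension of the ring (that is, depth = dimension). -/
def IsCohenMacaulayLocal (R : Type*) [CommRing R] [IsLocalRing R] : Prop :=
  IsNoetherianRing R ∧
    ∃ rs : List R, (∀ r ∈ rs, r ∈ maximalIdeal R) ∧ RingTheory.Sequence.IsRegular R rs ∧
      ringKrullDim R = ((rs.length : ℕ) : WithBot ℕ∞)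

/-- `I` is primary to the maximal ideal of the local ring `R`. -/
def IsMPrimary {R : Type*} [CommRing R] [IsLocalRing R] (I : Ideal R) : Prop :=
  I.IsPrimary ∧ I.radical = maximalIdeal R

/-- `J` is a reduction of `I`: `J ⊆ I` and `J * I ^ n = I ^ (n + 1)` for some `n`. -/
def IsReduction {R : Type*} [CommRing R] (J I : Ideal R) : Prop :=
  J ≤ I ∧ ∃ n : ℕ, J * I ^ n = I ^ (n + 1)

/-- `J` is a minimal reduction of `I`: a reduction that contains no smaller reduction. -/
def IsMinimalReduction {R : Type*} [CommRing R] (J I : Ideal R) : Prop :=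
  IsReduction J I ∧ ∀ J' : Ideal R, J' ≤ J → IsReduction J' I → J' = J

/-- `x ∈ I₂` is superficial for `I₂` and `I₁`: for some `r₀ > 0`, for all `r ≥ r₀` and `s ≥ 0`,
`x R ∩ I₁ ^ s I₂ ^ r = x I₁ ^ s I₂ ^ (r - 1)`. -/
def IsSuperficial {R : Type*} [CommRing R] (I₂ I₁ : Ideal R) (x : R) : Prop :=
  x ∈ I₂ ∧ ∃ r₀ : ℕ, 0 < r₀ ∧ ∀ r s : ℕ, r₀ ≤ r →
    Ideal.span {x} ⊓ (I₁ ^ s * I₂ ^ r) = Ideal.span {x} * (I₁ ^ s * I₂ ^ (r - 1))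

/-- `x₁, …, x_k` is a superficial sequence for `I₂` and `I₁`: for each `i` the image of `x_i` in
`R / (x₁, …, x_{i-1})` is superficial for the images of `I₂` and `I₁`. -/
def IsSuperficialSequence {R : Type*} [CommRing R] {k : ℕ} (I₂ I₁ : Ideal R) (x : Fin k → R) :
    Prop :=
  ∀ i : Fin k,
    IsSuperficial
      (I₂.map (Ideal.Quotient.mk (Ideal.span (x '' {j | j < i}))))
      (I₁.map (Ideal.Quotient.mk (Ideal.span (x '' {j | j < i}))))
      (Ideal.Quotient.mk (Ideal.span (x '' {j | j < i})) (x i))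

/-- The length of a module of finite length, as a natural number. -/
def len (R M : Type*) [CommRing R] [AddCommGroup M] [Module R M] : ℕ :=
  (Module.length R M).toNat

/-- The module `A / B`, for ideals `B ⊆ A`. -/
abbrev SubQuot {R : Type*} [CommRing R] (A B : Ideal R) : Type _ :=
  A ⧸ B.submoduleOf A

/-- The filtration `n ↦ I₁ I₂ ^ n`, `n ∈ ℤ`, where `I₂ ^ n = R` for `n ≤ 0`. -/
def filt {R : Type*} [CommRing R] (I₁ I₂ : Ideal R) (n : ℤ) : Ideal R :=
  I₁ * I₂ ^ n.toNat

section Complex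

variable {R : Type*} [CommRing R] {I₁ I₂ : Ideal R} {k : ℕ}

theorem filt_le_comap {x : R} (hx : x ∈ I₂) (n : ℤ) (i : ℕ) :
    filt I₁ I₂ (n - ((i + 1 : ℕ) : ℤ)) ≤
      Submodule.comap (LinearMap.lsmul R R x) (filt I₁ I₂ (n - (i : ℤ))) := by
  intro y hy
  have h1 : x * y ∈ I₂ * filt I₁ I₂ (n - ((i + 1 : ℕ) : ℤ)) := Ideal.mul_mem_mul hx hy
  have h2 : I₂ * filt I₁ I₂ (n - ((i + 1 : ℕ) : ℤ)) ≤ filt I₁ I₂ (n - (i : ℤ)) := by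
    unfold filt
    rw [mul_left_comm, ← pow_succ']
    exact Ideal.mul_mono_right (Ideal.pow_le_pow_right (by omega))
  exact h2 h1

/-- Multiplication by `x ∈ I₂` as a map `R / I₁ I₂ ^ (n - i - 1) → R / I₁ I₂ ^ (n - i)`. -/
def mulMap (I₁ : Ideal R) {x : R} (hx : x ∈ I₂) (n : ℤ) (i : ℕ) :
    (R ⧸ filt I₁ I₂ (n - ((i + 1 : ℕ) : ℤ))) →ₗ[R] (R ⧸ filt I₁ I₂ (n - (i : ℤ))) :=
  Submodule.mapQ _ _ (LinearMap.lsmul R R x) (filt_le_comap hx n i)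

/-- The basis of the `i`-th module of the Koszul complex: subsets of `{1, …, k}` of size `i`. -/
abbrev Idx (k i : ℕ) : Type := {s : Finset (Fin k) // s.card = i}

/-- The `i`-th module `(R / I₁ I₂ ^ (n - i)) ^ (k choose i)` of `C(x_k, (1, n))`. -/
abbrev CMod (I₁ I₂ : Ideal R) (k : ℕ) (n : ℤ) (i : ℕ) : Type _ :=
  Idx k i → R ⧸ filt I₁ I₂ (n - (i : ℤ))

/-- The set `t ∪ {j}`, for `j ∉ t`. -/
def Idx.insert {i : ℕ} (t : Idx k i) (j : {j : Fin k // j ∉ t.1}) : Idx k (i + 1) :=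
  ⟨Insert.insert j.1 t.1, by rw [Finset.card_insert_of_notMem j.2, t.2]⟩

/-- The Koszul sign of `j` with respect to `t`. -/
def sgn (R : Type*) [CommRing R] (t : Finset (Fin k)) (j : Fin k) : R :=
  (-1) ^ (t.filter (· < j)).card

/-- The differential from degree `i + 1` to degree `i` of `C(x_k, (1, n))`, induced by that of the
Koszul complex, `e_s ↦ ∑_{j ∈ s} ± x_j e_{s ∖ j}`. The coefficient at `e_t` of the image of `f` is
`∑_{j ∉ t} ± x_j f (t ∪ {j})`. -/
def cDiff (I₁ : Ideal R) (x : Fin k → R) (hx : ∀ j, x j ∈ I₂) (n : ℤ) (i : ℕ) :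
    CMod I₁ I₂ k n (i + 1) →ₗ[R] CMod I₁ I₂ k n i :=
  LinearMap.pi fun t : Idx k i =>
    ∑ j : {j : Fin k // j ∉ t.1},
      sgn R t.1 j.1 • (mulMap I₁ (hx j.1) n i ∘ₗ LinearMap.proj (t.insert j))

/-- The cycles in degree `i`. -/
def cycles (I₁ : Ideal R) (x : Fin k → R) (hx : ∀ j, x j ∈ I₂) (n : ℤ) :
    (i : ℕ) → Submodule R (CMod I₁ I₂ k n i)
  | 0 => ⊤
  | i + 1 => LinearMap.ker (cDiff I₁ x hx n i)

/-- The boundaries in degree `i`. -/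
def boundaries (I₁ : Ideal R) (x : Fin k → R) (hx : ∀ j, x j ∈ I₂) (n : ℤ) (i : ℕ) :
    Submodule R (CMod I₁ I₂ k n i) :=
  LinearMap.range (cDiff I₁ x hx n i)

theorem cDiff_apply_mk (x : Fin k → R) (hx : ∀ j, x j ∈ I₂) (n : ℤ) (i : ℕ)
    (r : Idx k (i + 1) → R) (t : Idx k i) :
    cDiff I₁ x hx n i (fun s => Submodule.Quotient.mk (r s)) t =
      Submodule.Quotient.mk
        (∑ j : {j : Fin k // j ∉ t.1}, sgn R t.1 j.1 * (x j.1 * r (t.insert j))) := by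
  have h := map_sum (Submodule.mkQ (filt I₁ I₂ (n - (i : ℤ))))
    (fun j : {j : Fin k // j ∉ t.1} => sgn R t.1 j.1 * (x j.1 * r (t.insert j))) Finset.univ
  simp only [Submodule.mkQ_apply] at h
  rw [h]
  simp only [cDiff, LinearMap.pi_apply, LinearMap.sum_apply, LinearMap.smul_apply]
  rfl

theorem sgn_swap (t : Finset (Fin k)) {j l : Fin k} (hj : j ∉ t) (hl : l ∉ t) (hjl : j ≠ l) :
    sgn R t j * sgn R (insert j t) l = - (sgn R t l * sgn R (insert l t) j) := by
  unfold sgn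
  rw [Finset.filter_insert, Finset.filter_insert]
  rcases lt_or_gt_of_ne hjl with h | h
  · rw [if_pos h, if_neg h.asymm, Finset.card_insert_of_notMem (by simp [hj])]
    ring
  · rw [if_neg h.asymm, if_pos h, Finset.card_insert_of_notMem (by simp [hl])]
    ring

/-- `C(x_k, (1, n))` is a complex. -/
theorem cDiff_cDiff (x : Fin k → R) (hx : ∀ j, x j ∈ I₂) (n : ℤ) (i : ℕ)
    (f : CMod I₁ I₂ k n (i + 2)) :
    cDiff I₁ x hx n i (cDiff I₁ x hx n (i + 1) f) = 0 := by
  choose r hr using fun s => Submodule.Quotient.mk_surjective _ (f s)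
  obtain rfl : (fun s => Submodule.Quotient.mk (r s)) = f := funext hr
  rw [show cDiff I₁ x hx n (i + 1) (fun s => Submodule.Quotient.mk (r s)) = _ from
    funext fun t => cDiff_apply_mk x hx n (i + 1) r t]
  ext t
  rw [cDiff_apply_mk]
  refine (congrArg _ ?_).trans (Submodule.Quotient.mk_zero _)
  simp only [Finset.mul_sum]
  rw [Finset.sum_sigma']
  refine Finset.sum_involution
    (fun p _ => ⟨⟨p.2.1, fun h => p.2.2 (Finset.mem_insert_of_mem h)⟩, ⟨p.1.1, ?_⟩⟩) ?_ ?_ ?_ ?_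
  · intro h
    rcases Finset.mem_insert.1 h with h | h
    · exact p.2.2 (h ▸ Finset.mem_insert_self _ _)
    · exact p.1.2 h
  · rintro ⟨⟨j, hj⟩, ⟨l, hl⟩⟩ -
    have hl' : l ≠ j ∧ l ∉ t.1 := by simpa [Idx.insert] using hl
    have e : ∀ h1 h2 h3 h4, (t.insert ⟨j, h1⟩).insert ⟨l, h2⟩ =
        (t.insert ⟨l, h3⟩).insert ⟨j, h4⟩ := fun _ _ _ _ =>
      Subtype.ext (Finset.insert_comm _ _ _)
    dsimp only
    rw [e hj hl hl'.2 (by simp [Idx.insert, hj, hl'.1.symm])]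
    have h := sgn_swap (R := R) t.1 hj hl'.2 hl'.1.symm
    simp only [Idx.insert] at h ⊢
    linear_combination (x j * x l * r _) * h
  · rintro ⟨⟨j, hj⟩, ⟨l, hl⟩⟩ - - h
    have hl' : l ≠ j ∧ l ∉ t.1 := by simpa [Idx.insert] using hl
    exact hl'.1 (congrArg (fun p => p.1.1) h)
  · intros; simp
  · rintro ⟨⟨j, hj⟩, ⟨l, hl⟩⟩ -
    rfl

theorem boundaries_le_cycles (x : Fin k → R) (hx : ∀ j, x j ∈ I₂) (n : ℤ) (i : ℕ) :
    boundaries I₁ x hx n i ≤ cycles I₁ x hx n i := by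
  cases i with
  | zero => exact le_top
  | succ i =>
    rintro _ ⟨f, rfl⟩
    exact cDiff_cDiff x hx n i f

/-- The homology module `H_i(C(x_k, (1, n)))`. -/
abbrev CHomology (I₁ : Ideal R) (x : Fin k → R) (hx : ∀ j, x j ∈ I₂) (n : ℤ) (i : ℕ) : Type _ :=
  cycles I₁ x hx n i ⧸ (boundaries I₁ x hx n i).submoduleOf (cycles I₁ x hx n i)

/-- `h_i(C, x_k)(1, n)`, the length of `H_i(C(x_k, (1, n)))`. -/
def hC (I₁ : Ideal R) (x : Fin k → R) (hx : ∀ j, x j ∈ I₂) (n : ℤ) (i : ℕ) : ℕ :=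
  len R (CHomology I₁ x hx n i)

end Complex

/-- `g₀, …, g_d` are the coefficients of the Hilbert polynomial of `n ↦ ℓ(R / I₁ I₂ ^ n)`: for
all large `n`, `ℓ(R / I₁ I₂ ^ n) = ∑_{j = 0}^d (-1) ^ j g_j (n + d - j - 1 choose d - j)`. -/
def IsHilbertCoeffs {R : Type*} [CommRing R] (d : ℕ) (I₁ I₂ : Ideal R) (g : Fin (d + 1) → ℤ) :
    Prop :=
  ∀ᶠ n : ℕ in atTop,
    (len R (R ⧸ I₁ * I₂ ^ n) : ℤ) =
      ∑ j : Fin (d + 1), (-1) ^ (j : ℕ) * g j *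
        (((n + (d - (j : ℕ)) - 1).choose (d - (j : ℕ)) : ℕ) : ℤ)

/-- `e` is the multiplicity of `I`: the limit of `d! ℓ(R / I ^ n) / n ^ d`, where `d = dim R`. -/
def HasMultiplicity {R : Type*} [CommRing R] (d : ℕ) (I : Ideal R) (e : ℤ) : Prop :=
  Tendsto (fun n : ℕ => (d.factorial : ℝ) * (len R (R ⧸ I ^ n) : ℝ) / (n : ℝ) ^ d) atTop
    (𝓝 (e : ℝ))

end FiberCone

end

namespace FiberCone

/-! Write Q = (x), f(n) = ℓ(R/I₁I₂ⁿ) for n ∈ ℤ, and Δ for the backward difference. The proof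
compares two readings of Δᵈf.

For every n, Δᵈf(n) is the alternating sum of the lengths of the terms of C(x, (1, n)), hence the
Euler characteristic Σ(-1)ʲhⱼ (`euler_characteristic`). For large n, Δᵈf(n) is the constant c =
ℓ(R/Q): the xᵢ form a regular sequence because R is Cohen–Macaulay
(`IsCohenMacaulayLocal.mul_mem_span_iff`), and superficiality then makes each Δ amount to killing
one more xᵢ (`eventually_bdiff_iterate_len`). So f agrees for large n with a polynomial P, and g₀ =
c; the same argument for ℓ(R/I₂ⁿ) gives e(I₂) = c.

Now G = Δᵈ⁻ⁱ(P - f) vanishes for large n, and ΔⁱG = c - Δᵈf. Repeated summation by parts gives Σ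
C(n, i-1) ΔⁱG(n+1) = (-1)ⁱG(0) (`hasSum_choose_mul_bdiff`). Here Δᵈ⁻ⁱP(0) = (-1)ⁱgᵢ, while Δᵈ⁻ⁱf(0)
is zero unless i = d, because f is constant on n ≤ 0; for i = d it is ℓ(R/I₁), the correction term
(`hasSum_hilbertCoeff`).

It remains to rewrite c - Δᵈf(n+1). As H₀ = R/(I₁I₂ⁿ⁺¹ + Q), the difference c - h₀ is the first
length in the theorem. Since the first Koszul homology of a regular sequence vanishes, h₁ =
ℓ((I₁I₂ⁿ⁺¹ ∩ Q)/QI₁I₂ⁿ) (`hC_one`), and adding h₁ to the first length gives the second. -/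

/-! ### Backward differences -/

/-- The backward difference operator. -/
def bdiff (f : ℤ → ℤ) : ℤ → ℤ := fun n => f n - f (n - 1)

theorem bdiff_sub (f g : ℤ → ℤ) : bdiff (f - g) = bdiff f - bdiff g := by
  funext n
  simp only [bdiff, Pi.sub_apply]
  ring

theorem bdiff_iterate_sub (f g : ℤ → ℤ) (m : ℕ) :
    bdiff^[m] (f - g) = bdiff^[m] f - bdiff^[m] g := by
  induction m generalizing f g with
  | zero => rfl
  | succ m ih => rw [Function.iterate_succ_apply, bdiff_sub, ih]; rfl

theorem tendsto_sub_one_atTop : Tendsto (fun n : ℤ => n - 1) atTop atTop :=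
  tendsto_atTop_add_const_right _ (-1) tendsto_id

theorem bdiff_congr {f g : ℤ → ℤ} (h : f =ᶠ[atTop] g) : bdiff f =ᶠ[atTop] bdiff g := by
  filter_upwards [h, tendsto_sub_one_atTop.eventually h] with n h1 h2
  rw [bdiff, bdiff, h1, h2]

theorem bdiff_iterate_congr {f g : ℤ → ℤ} (h : f =ᶠ[atTop] g) (m : ℕ) :
    bdiff^[m] f =ᶠ[atTop] bdiff^[m] g := by
  induction m generalizing f g with
  | zero => exact h
  | succ m ih => exact ih (bdiff_congr h)

theorem bdiff_iterate_zero (m : ℕ) : bdiff^[m] 0 = 0 := by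
  induction m with
  | zero => rfl
  | succ m ih =>
    rw [Function.iterate_succ_apply, show bdiff 0 = 0 from funext fun n => sub_self _, ih]

theorem bdiff_iterate_eq_sum (f : ℤ → ℤ) (m : ℕ) (n : ℤ) :
    bdiff^[m] f n = ∑ i ∈ Finset.range (m + 1), (-1) ^ i * ((m.choose i : ℕ) : ℤ) * f (n - i) := by
  have h : ∀ (m : ℕ) (f : ℤ → ℤ), bdiff^[m] f = ((-1 : ℤ) ^ m) • (fwdDiff (-1 : ℤ))^[m] f := by
    intro m
    induction m with
    | zero => intro f; simp
    | succ m ih =>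
      intro f
      rw [Function.iterate_succ_apply, ih, Function.iterate_succ_apply,
        -- A backward difference is minus the forward difference of step -1.
        show bdiff f = (-1 : ℤ) • fwdDiff (-1 : ℤ) f from ?_, fwdDiff_iter_const_smul,
        smul_smul, pow_succ]
      funext n
      simp [bdiff, fwdDiff, sub_eq_add_neg]
  rw [h, Pi.smul_apply, fwdDiff_iter_eq_sum_shift, Finset.smul_sum]
  refine Finset.sum_congr rfl fun i hi => ?_
  have hi : i ≤ m := Nat.lt_succ_iff.1 (Finset.mem_range.1 hi)
  obtain ⟨k, rfl⟩ := Nat.exists_eq_add_of_le hi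
  have e : (-1 : ℤ) ^ (i + k) * (-1) ^ k = (-1) ^ i := by
    rw [pow_add, mul_assoc, ← mul_pow]; simp
  simp only [smul_eq_mul, Nat.add_sub_cancel_left, ← mul_assoc, e]
  simp [sub_eq_add_neg]

theorem bdiff_iterate_eq_zero_of_const {f : ℤ → ℤ} (hf : ∀ n ≤ 0, f n = f 0) {m : ℕ}
    (hm : m ≠ 0) {n : ℤ} (hn : n ≤ 0) : bdiff^[m] f n = 0 := by
  rw [bdiff_iterate_eq_sum]
  rw [Finset.sum_congr rfl fun i _ => by rw [hf (n - i) (by omega)], ← Finset.sum_mul,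
    Int.alternating_sum_range_choose_of_ne hm, zero_mul]

/-! ### Hilbert polynomials in the binomial basis -/

/-- The function `n ↦ ∑_{j = 0}^d (-1) ^ j g_j (n + d - j - 1 choose d - j)` on the integers. -/
noncomputable def hpoly (d : ℕ) (g : ℕ → ℤ) : ℤ → ℤ := fun n =>
  ∑ j ∈ Finset.range (d + 1), (-1) ^ j * g j * Ring.multichoose n (d - j)

theorem hpoly_zero (g : ℕ → ℤ) (n : ℤ) : hpoly 0 g n = g 0 := by
  simp [hpoly]

theorem bdiff_multichoose (k : ℕ) (n : ℤ) :
    Ring.multichoose n (k + 1) - Ring.multichoose (n - 1) (k + 1) = Ring.multichoose n k := by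
  have h := Ring.multichoose_succ_succ (n - 1) k
  rw [sub_add_cancel] at h
  rw [h]
  ring

theorem bdiff_hpoly (d : ℕ) (g : ℕ → ℤ) : bdiff (hpoly (d + 1) g) = hpoly d g := by
  funext n
  rw [bdiff, hpoly, hpoly, hpoly, Finset.sum_range_succ, Finset.sum_range_succ _ (d + 1)]
  simp only [Nat.sub_self, Ring.multichoose_zero_right, mul_one]
  rw [add_sub_add_right_eq_sub, ← Finset.sum_sub_distrib]
  refine Finset.sum_congr rfl fun j hj => ?_
  rw [Nat.sub_add_comm (Nat.lt_succ_iff.1 (Finset.mem_range.1 hj))]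
  linear_combination ((-1) ^ j * g j) * bdiff_multichoose (d - j) n

theorem bdiff_iterate_hpoly (m d : ℕ) (g : ℕ → ℤ) :
    bdiff^[m] (hpoly (d + m) g) = hpoly d g := by
  induction m with
  | zero => rfl
  | succ m ih => rw [Function.iterate_succ_apply, ← add_assoc, bdiff_hpoly, ih]

/-- Every basis polynomial of positive degree vanishes at 0. This is how a single coefficient is
extracted. -/
theorem hpoly_apply_zero (d : ℕ) (g : ℕ → ℤ) : hpoly d g 0 = (-1) ^ d * g d := by
  rw [hpoly, Finset.sum_range_succ, Finset.sum_eq_zero fun j hj => ?_]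
  · simp
  · obtain ⟨k, hk⟩ := Nat.exists_eq_add_of_lt (Finset.mem_range.1 hj)
    rw [show d - j = k + 1 by omega, Ring.multichoose_zero_succ, mul_zero]

/-! ### Summation by parts -/

theorem sum_choose_mul_bdiff (D : ℤ → ℤ) (k N : ℕ) :
    ∑ n ∈ Finset.range N, ((n.choose (k + 1) : ℕ) : ℤ) * bdiff D (n + 1) =
      ((N.choose (k + 1) : ℕ) : ℤ) * D N -
        ∑ n ∈ Finset.range N, ((n.choose k : ℕ) : ℤ) * D (n + 1) := by
  induction N with
  | zero => simp
  | succ N ih =>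
    rw [Finset.sum_range_succ, ih, Finset.sum_range_succ, Nat.choose_succ_succ, bdiff]
    push_cast
    rw [add_sub_cancel_right]
    ring

/-- Each summation by parts removes one difference and flips the sign; its boundary term at N
vanishes for large N. What remains at the end is a telescoping sum G(N) - G(0) = -G(0). -/
theorem eventually_sum_choose_mul_bdiff {G : ℤ → ℤ} (hG : G =ᶠ[atTop] 0) (k : ℕ) :
    ∀ᶠ N : ℕ in atTop,
      ∑ n ∈ Finset.range N, ((n.choose k : ℕ) : ℤ) * bdiff^[k + 1] G (n + 1) =
        (-1) ^ (k + 1) * G 0 := by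
  induction k with
  | zero =>
    filter_upwards [tendsto_natCast_atTop_atTop.eventually hG] with N hN
    have h := Finset.sum_range_sub (fun n : ℕ => G n) N
    rw [hN] at h
    simp only [Nat.choose_zero_right, Nat.cast_one, one_mul, zero_add, Function.iterate_one,
      bdiff, add_sub_cancel_right]
    push_cast at h
    rw [h]
    simp
  | succ k ih =>
    have h := bdiff_iterate_congr hG (k + 1)
    rw [bdiff_iterate_zero] at h
    filter_upwards [ih, tendsto_natCast_atTop_atTop.eventually h] with N h1 h2
    simp only [Function.iterate_succ_apply' bdiff (k + 1)]
    rw [sum_choose_mul_bdiff, h1, h2, pow_succ _ (k + 1)]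
    simp

/-- The summand vanishes for large n, so the sum is a finite one. Restricting to n ≥ k loses
nothing, as the binomial coefficient is zero below k. -/
theorem hasSum_choose_mul_bdiff {G : ℤ → ℤ} (hG : G =ᶠ[atTop] 0) (k : ℕ) :
    HasSum (fun n : Set.Ici k => (((n : ℕ).choose k : ℕ) : ℤ) * bdiff^[k + 1] G ((n : ℕ) + 1))
      ((-1) ^ (k + 1) * G 0) := by
  have h := bdiff_iterate_congr hG (k + 1)
  rw [bdiff_iterate_zero] at h
  obtain ⟨A, hA⟩ := eventually_atTop.1 (tendsto_natCast_atTop_atTop.eventually h)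
  obtain ⟨B, hB⟩ := eventually_atTop.1 (eventually_sum_choose_mul_bdiff hG k)
  rw [← hB (max A B) (le_max_right _ _)]
  have hs : Function.support
      (fun n : ℕ => ((n.choose k : ℕ) : ℤ) * bdiff^[k + 1] G ((n : ℤ) + 1)) ⊆ Set.Ici k := by
    intro n hn
    by_contra h
    exact hn (by simp [Nat.choose_eq_zero_of_lt (not_le.1 h)])
  refine (hasSum_subtype_iff_of_support_subset hs).2 (hasSum_sum_of_ne_finset_zero ?_)
  intro n hn
  have hn : A ≤ n + 1 := by
    have := le_max_left A B
    simp only [Finset.mem_range, not_lt] at hn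
    omega
  have := hA (n + 1) hn
  push_cast at this
  rw [this]
  simp

/-! ### Existence and growth of the Hilbert polynomial -/

theorem exists_eventuallyEq_const_of_bdiff {f : ℤ → ℤ} (h : bdiff f =ᶠ[atTop] 0) :
    ∃ c : ℤ, ∀ᶠ n in atTop, f n = c := by
  obtain ⟨N, hN⟩ := eventually_atTop.1 h
  refine ⟨f N, eventually_atTop.2 ⟨N, fun n hn => ?_⟩⟩
  induction n, hn using Int.leInduction with
  | base => rfl
  | succ n hn ih =>
    have := hN (n + 1) (by omega)
    simp only [bdiff, add_sub_cancel_right, Pi.zero_apply] at this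
    omega

theorem exists_eventuallyEq_hpoly {d : ℕ} {f : ℤ → ℤ} {c : ℤ}
    (h : ∀ᶠ n in atTop, bdiff^[d] f n = c) : ∃ g : ℕ → ℤ, f =ᶠ[atTop] hpoly d g := by
  induction d generalizing f with
  | zero =>
    refine ⟨fun _ => c, ?_⟩
    filter_upwards [h] with n hn
    rw [hpoly_zero]
    exact hn
  | succ d ih =>
    obtain ⟨g, hg⟩ := ih h
    obtain ⟨e, he⟩ := exists_eventuallyEq_const_of_bdiff (f := f - hpoly (d + 1) g) <| by
      rw [bdiff_sub, bdiff_hpoly]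
      filter_upwards [hg] with n hn
      rw [Pi.sub_apply, hn, sub_self, Pi.zero_apply]
    -- The constant of integration `e` goes into the last coefficient, whose basis polynomial is 1;
    -- the sign cancels the one in `hpoly`.
    refine ⟨fun j => if j = d + 1 then g j + (-1) ^ (d + 1) * e else g j, ?_⟩
    filter_upwards [he] with n hn
    rw [Pi.sub_apply, sub_eq_iff_eq_add] at hn
    have e2 : ∀ j ∈ Finset.range (d + 1), (-1) ^ j * g j * Ring.multichoose n (d + 1 - j) =
        (-1) ^ j * (if j = d + 1 then g j + (-1) ^ (d + 1) * e else g j) *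
          Ring.multichoose n (d + 1 - j) := fun j hj => by
      rw [if_neg (Finset.mem_range.1 hj).ne]
    rw [hn, hpoly, hpoly, Finset.sum_range_succ, Finset.sum_range_succ _ (d + 1), if_pos rfl,
      Finset.sum_congr rfl e2]
    have e1 : (-1 : ℤ) ^ (d + 1) * (-1) ^ (d + 1) = 1 := by rw [← mul_pow]; simp
    simp only [Nat.sub_self, Ring.multichoose_zero_right, mul_one]
    linear_combination (-e) * e1

theorem multichoose_natCast (n k : ℕ) :
    Ring.multichoose (n : ℤ) k = (((n + k - 1).choose k : ℕ) : ℤ) := by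
  rw [Ring.multichoose_eq]
  rcases Nat.eq_zero_or_pos (n + k) with h | h
  -- Only here does the natural subtraction `n + k - 1` truncate; both sides are then 1.
  · obtain ⟨rfl, rfl⟩ : n = 0 ∧ k = 0 := by omega
    simp
  · rw [← Ring.choose_natCast, Nat.cast_sub h]
    push_cast
    rfl

theorem succ_mul_multichoose_succ (n k : ℕ) :
    ((k : ℤ) + 1) * Ring.multichoose (n : ℤ) (k + 1) = (n + k) * Ring.multichoose (n : ℤ) k := by
  rw [multichoose_natCast, multichoose_natCast]
  rcases Nat.eq_zero_or_pos (n + k) with h | h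
  · obtain ⟨rfl, rfl⟩ : n = 0 ∧ k = 0 := by omega
    simp
  · have := Nat.add_one_mul_choose_eq (n + k - 1) k
    rw [Nat.sub_add_cancel h] at this
    rw [show n + (k + 1) - 1 = n + k by omega]
    have := congrArg (Nat.cast : ℕ → ℤ) this
    push_cast at this
    linarith

theorem tendsto_multichoose_div_pow (k : ℕ) :
    Tendsto (fun n : ℕ => ((Ring.multichoose (n : ℤ) k : ℤ) : ℝ) / (n : ℝ) ^ k) atTop
      (𝓝 (1 / (k.factorial : ℝ))) := by
  induction k with
  | zero => simp
  | succ k ih =>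
    have h1 : Tendsto (fun n : ℕ => (1 + (k : ℝ) / n) * (1 / ((k : ℝ) + 1))) atTop
        (𝓝 ((1 + 0) * (1 / ((k : ℝ) + 1)))) :=
      (tendsto_const_nhds.add (tendsto_const_div_atTop_nhds_zero_nat _)).mul_const _
    have h2 := ih.mul h1
    have hk : (k : ℝ) + 1 ≠ 0 := by positivity
    rw [show 1 / (k.factorial : ℝ) * ((1 + 0) * (1 / ((k : ℝ) + 1))) =
      1 / ((k + 1).factorial : ℝ) by
        rw [Nat.factorial_succ]; push_cast; field_simp; ring] at h2
    refine h2.congr' ?_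
    filter_upwards [eventually_gt_atTop 0] with n hn
    have hn : (n : ℝ) ≠ 0 := by positivity
    have h3 := congrArg (Int.cast : ℤ → ℝ) (succ_mul_multichoose_succ n k)
    push_cast at h3
    field_simp
    linear_combination (-(n:ℝ)^(k+1)) * h3

/-- The j-th summand has degree at most d - j, so after division by nᵈ only j = 0 contributes to the
limit. -/
theorem tendsto_hpoly_div_pow (d : ℕ) (g : ℕ → ℤ) :
    Tendsto (fun n : ℕ => (d.factorial : ℝ) * ((hpoly d g n : ℤ) : ℝ) / (n : ℝ) ^ d) atTop
      (𝓝 (g 0 : ℝ)) := by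
  have h : ∀ j ∈ Finset.range (d + 1), Tendsto (fun n : ℕ => (d.factorial : ℝ) *
      (((-1) ^ j * g j * Ring.multichoose (n : ℤ) (d - j) : ℤ) : ℝ) / (n : ℝ) ^ d) atTop
      (𝓝 (if j = 0 then (g 0 : ℝ) else 0)) := by
    intro j hj
    have hj : j ≤ d := Nat.lt_succ_iff.1 (Finset.mem_range.1 hj)
    have h1 := (((tendsto_multichoose_div_pow (d - j)).mul
      ((tendsto_inv_atTop_nhds_zero_nat (𝕜 := ℝ)).pow j)).const_mul
        ((d.factorial : ℝ) * ((-1) ^ j * g j)))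
    have e : (d.factorial : ℝ) * ((-1) ^ j * g j) * (1 / ((d - j).factorial : ℝ) * 0 ^ j) =
        if j = 0 then (g 0 : ℝ) else 0 := by
      split_ifs with h0
      · subst h0
        have : (d.factorial : ℝ) ≠ 0 := by positivity
        simp only [pow_zero, Nat.sub_zero]
        field_simp
      · simp [h0]
    rw [e] at h1
    refine h1.congr' ?_
    filter_upwards [eventually_gt_atTop 0] with n hn
    have hn : (n : ℝ) ≠ 0 := by positivity
    rw [show (n : ℝ) ^ d = (n : ℝ) ^ (d - j) * n ^ j by rw [← pow_add, Nat.sub_add_cancel hj]]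
    rw [inv_pow]
    push_cast
    field_simp
  have h2 := tendsto_finsetSum _ h
  rw [Finset.sum_ite_eq' _ _ (fun _ => (g 0 : ℝ)), if_pos (by simp)] at h2
  refine h2.congr fun n => ?_
  rw [← Finset.sum_div, ← Finset.mul_sum, hpoly]
  push_cast
  rfl

universe u

open RingTheory.Sequence CategoryTheory Abelian Pointwise

/-! ### Systems of parameters in Cohen–Macaulay rings are regular sequences -/

theorem ringKrullDim_quotient_add_one_le {R : Type*} [CommRing R] {p q : Ideal R}
    (hp : p.IsPrime) (hpq : p ≤ q) {y : R} (hyp : y ∉ p) (hyq : y ∈ q) : ringKrullDim (R ⧸ q) + 1 ≤ ringKrullDim (R ⧸ p) := by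
  have hy : Ideal.Quotient.mk p y ∈ nonZeroDivisors (R ⧸ p) :=
    mem_nonZeroDivisors_of_ne_zero fun h => hyp (Ideal.Quotient.eq_zero_iff_mem.1 h)
  refine le_trans (add_le_add_left ?_ 1) (ringKrullDim_quotient_succ_le_of_nonZeroDivisor hy)
  refine ringKrullDim_le_of_surjective
    (Ideal.Quotient.lift (Ideal.span {Ideal.Quotient.mk p y}) (Ideal.Quotient.factor hpq) ?_) ?_
  · intro a ha
    obtain ⟨b, rfl⟩ := Ideal.mem_span_singleton.1 ha
    simp [Ideal.Quotient.eq_zero_iff_mem.2 hyq]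
  · exact Ideal.Quotient.lift_surjective_of_surjective _ _ (Ideal.Quotient.factor_surjective hpq)

/-- In the long exact Ext sequence of 0 → M → M → M/yM → 0, Extⁱ(N, M/yM) sits between Extⁱ(N, M)
and Extⁱ⁺¹(N, M). -/
theorem subsingleton_ext_quotSMulTop {R : Type u} [CommRing R] {N M : ModuleCat.{u} R} {y : R}
    (hy : IsSMulRegular M y) {n : ℕ} (h : ∀ i < n + 1, Subsingleton (Ext N M i)) :
    ∀ i < n, Subsingleton (Ext N (ModuleCat.of R (QuotSMulTop y M)) i) := by
  intro i hi
  have zero1 := AddCommGrpCat.isZero_of_iff_subsingleton.mpr (h i (by omega))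
  have zero2 := AddCommGrpCat.isZero_of_iff_subsingleton.mpr (h (i + 1) (by omega))
  exact AddCommGrpCat.subsingleton_of_isZero <| ShortComplex.Exact.isZero_of_both_zeros
    ((Ext.covariant_sequence_exact₃' N hy.smulShortComplex_shortExact) i (i + 1) rfl)
    (zero1.eq_zero_of_src _) (zero2.eq_zero_of_tgt _)

section Regular

variable {R : Type u} [CommRing R] [IsLocalRing R] [IsNoetherianRing R]

/-- Let N be the submodule killed by p. Since y is regular, N ⊆ yM would force N = yN, hence N = 0
by Nakayama, although p ∈ Ass M. So some element of N has nonzero image in M/yM; this image is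
killed by p and y, and its annihilator lies in an associated prime. -/
theorem exists_isAssociatedPrime_quotSMulTop {M : Type u} [AddCommGroup M] [Module R M]
    [Module.Finite R M] {y : R} (hy : y ∈ maximalIdeal R) (hreg : IsSMulRegular M y)
    {p : Ideal R} (hp : IsAssociatedPrime p M) :
    ∃ q, IsAssociatedPrime q (QuotSMulTop y M) ∧ p ≤ q ∧ y ∈ q := by
  obtain ⟨hprime, z, hz⟩ := isAssociatedPrime_iff.1 hp
  let N : Submodule R M := ⨅ r : p, LinearMap.ker (LinearMap.lsmul R M r)
  have hN : ∀ m, m ∈ N ↔ ∀ r ∈ p, r • m = 0 := by simp [N]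
  have hzN : z ∈ N := (hN z).2 fun r hr => by
    rw [hz, Submodule.mem_colon_singleton] at hr
    exact hr
  have hnot : ¬ N ≤ y • (⊤ : Submodule R M) := by
    intro hle
    have hbot : N = ⊥ := by
      refine Submodule.eq_bot_of_le_smul_of_le_jacobson_bot (Ideal.span {y}) N
        (IsNoetherian.noetherian N) ?_ ?_
      · intro m hm
        obtain ⟨m', -, rfl⟩ := (Submodule.mem_smul_pointwise_iff_exists _ _ _).1 (hle hm)
        rw [Submodule.ideal_span_singleton_smul]
        refine Submodule.smul_mem_pointwise_smul _ _ _ ((hN m').2 fun r hr => hreg ?_)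
        simpa [smul_comm y r] using (hN _).1 hm r hr
      · rw [Ideal.span_le, Set.singleton_subset_iff]
        exact maximalIdeal_le_jacobson _ hy
    rw [hbot, Submodule.mem_bot] at hzN
    rw [hzN] at hz
    refine hprime.ne_top (hz.trans ?_)
    ext r
    simp [Submodule.mem_colon_singleton]
  obtain ⟨m, hm, hmy⟩ := SetLike.not_le_iff_exists.1 hnot
  obtain ⟨q, hq, hle⟩ := exists_le_isAssociatedPrime_of_isNoetherianRing R
    (Submodule.Quotient.mk m : QuotSMulTop y M)
    (fun h => hmy ((Submodule.Quotient.mk_eq_zero _).1 h))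
  refine ⟨q, hq, fun r hr => hle ?_, hle ?_⟩
  · rw [Submodule.mem_colon_singleton, ← Submodule.Quotient.mk_smul, (hN m).1 hm r hr]
    simp
  · rw [Submodule.mem_colon_singleton, ← Submodule.Quotient.mk_smul, Submodule.mem_bot,
      Submodule.Quotient.mk_eq_zero]
    exact Submodule.smul_mem_pointwise_smul _ _ _ trivial

/-- Passing from M to M/yM enlarges p to a prime q containing y. As y is regular on M, y ∉ p, so the
dimension drops by at least one at each step. -/
theorem length_le_ringKrullDim_quotient_of_isAssociatedPrime {M : Type u} [AddCommGroup M]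
    [Module R M] [Module.Finite R M] (rs : List R) (hmem : ∀ r ∈ rs, r ∈ maximalIdeal R)
    (hreg : IsWeaklyRegular M rs) {p : Ideal R} (hp : IsAssociatedPrime p M) :
    ((rs.length : ℕ) : WithBot ℕ∞) ≤ ringKrullDim (R ⧸ p) := by
  induction rs generalizing M p with
  | nil =>
    have := hp.isPrime
    simpa using ringKrullDim_nonneg_of_nontrivial
  | cons y ys ih =>
    rw [isWeaklyRegular_cons_iff] at hreg
    obtain ⟨q, hq, hpq, hyq⟩ :=
      exists_isAssociatedPrime_quotSMulTop (hmem y (by simp)) hreg.1 hp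
    have hyp : y ∉ p := fun h => by
      have : y ∈ ⋃ p ∈ associatedPrimes R M, (p : Set R) := Set.mem_biUnion hp h
      rw [biUnion_associatedPrimes_eq_compl_regular] at this
      exact this hreg.1
    refine le_trans ?_ (ringKrullDim_quotient_add_one_le hp.isPrime hpq hyp hyq)
    rw [List.length_cons, Nat.cast_add, Nat.cast_one]
    exact add_le_add_left (ih (fun r hr => hmem r (by simp [hr])) hreg.2 hq) 1

/-- Dividing R/p by the images of `xs` leaves a ring whose primes all pull back to the maximal
ideal, so of dimension at most 0; each element lowers the dimension by at most one. -/
theorem ringKrullDim_quotient_le_length {p : Ideal R} (hp : p.IsPrime) (xs : List R)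
    (hmem : ∀ r ∈ xs, r ∈ maximalIdeal R)
    (hrad : maximalIdeal R ≤ (p ⊔ Ideal.ofList xs).radical) :
    ringKrullDim (R ⧸ p) ≤ ((xs.length : ℕ) : WithBot ℕ∞) := by
  classical
  have : Nontrivial (R ⧸ p) := Ideal.Quotient.nontrivial_iff.2 hp.ne_top
  have : IsLocalRing (R ⧸ p) := .of_surjective' _ Ideal.Quotient.mk_surjective
  have hpm : p ≤ maximalIdeal R := le_maximalIdeal hp.ne_top
  have hmax : ∀ a : R, Ideal.Quotient.mk p a ∈ maximalIdeal (R ⧸ p) ↔ a ∈ maximalIdeal R := by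
    have : IsLocalHom (Ideal.Quotient.mk p) := .of_surjective _ Ideal.Quotient.mk_surjective
    intro a
    simp [mem_maximalIdeal, mem_nonunits_iff]
  let S : Finset (R ⧸ p) := (xs.map (Ideal.Quotient.mk p)).toFinset
  have hS : (S : Set (R ⧸ p)) ⊆ maximalIdeal (R ⧸ p) := by
    intro a ha
    simp only [S, List.coe_toFinset, List.mem_map, Set.mem_ofPred_eq] at ha
    obtain ⟨r, hr, rfl⟩ := ha
    exact (hmax r).2 (hmem r hr)
  have hspan : Ideal.span (S : Set (R ⧸ p)) = (Ideal.ofList xs).map (Ideal.Quotient.mk p) := by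
    rw [Ideal.map_ofList]
    simp [S, Ideal.ofList]
  refine (ringKrullDim_le_ringKrullDim_quotient_add_card S
    (by rwa [ringJacobson_eq_maximalIdeal])).trans ?_
  have hcard : S.card ≤ xs.length := (List.toFinset_card_le _).trans (by simp)
  have h0 : ringKrullDim ((R ⧸ p) ⧸ Ideal.span (S : Set (R ⧸ p))) ≤ 0 := by
    have hne : Ideal.span (S : Set (R ⧸ p)) ≠ ⊤ :=
      ne_top_of_le_ne_top (maximalIdeal.isMaximal (R ⧸ p)).ne_top (Ideal.span_le.2 hS)
    rw [← Nat.cast_zero, ← Ring.krullDimLE_iff, Ring.krullDimLE_zero_iff]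
    intro I hI
    have hI' := Ideal.comap_isPrime (Ideal.Quotient.mk (Ideal.span (S : Set (R ⧸ p)))) I
    have hI'' := Ideal.comap_isPrime (Ideal.Quotient.mk p)
      (I.comap (Ideal.Quotient.mk (Ideal.span (S : Set (R ⧸ p)))))
    have hle : p ⊔ Ideal.ofList xs ≤ (I.comap (Ideal.Quotient.mk (Ideal.span
        (S : Set (R ⧸ p))))).comap (Ideal.Quotient.mk p) := by
      refine sup_le (fun a ha => ?_) (fun a ha => ?_)
      · simp [Ideal.Quotient.eq_zero_iff_mem.2 ha]
      · have : Ideal.Quotient.mk p a ∈ Ideal.span (S : Set (R ⧸ p)) :=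
          hspan ▸ Ideal.mem_map_of_mem _ ha
        simp [Ideal.Quotient.eq_zero_iff_mem.2 this]
    have heq := (maximalIdeal.isMaximal R).eq_of_le hI''.ne_top
      (hrad.trans (hI''.radical_le_iff.2 hle))
    have hs : Function.Surjective ((Ideal.Quotient.mk (Ideal.span (S : Set (R ⧸ p)))).comp
        (Ideal.Quotient.mk p)) := Ideal.Quotient.mk_surjective.comp Ideal.Quotient.mk_surjective
    have hmap := Ideal.map_comap_of_surjective _ hs I
    rw [← Ideal.comap_comap, ← heq] at hmap
    have := Ideal.map_eq_top_or_isMaximal_of_surjective _ hs (maximalIdeal.isMaximal R)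
    rw [hmap] at this
    exact this.resolve_left hI.ne_top
  calc _ ≤ (0 : WithBot ℕ∞) + (S.card : WithBot ℕ∞) := by gcongr
    _ ≤ _ := by rw [zero_add]; exact_mod_cast hcard

/-- The annihilator in `hrad` makes the induction run: on M/yM the element y moves from the list
into the annihilator. Depth enters as vanishing of Ext from the residue field, which also descends
to M/yM. -/
theorem isWeaklyRegular_of_le_radical (M : ModuleCat.{u} R) [Module.Finite R M] [Nontrivial M]
    (xs : List R) (hmem : ∀ r ∈ xs, r ∈ maximalIdeal R)
    (hrad : maximalIdeal R ≤ (Module.annihilator R M ⊔ Ideal.ofList xs).radical)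
    (hext : ∀ i < xs.length,
      Subsingleton (Ext (ModuleCat.of R (R ⧸ maximalIdeal R)) M i)) :
    IsWeaklyRegular M xs := by
  induction xs generalizing M with
  | nil => exact .nil R M
  | cons y ys ih =>
    have hlt : maximalIdeal R • (⊤ : Submodule R M) < ⊤ :=
      lt_top_iff_ne_top.2 (Submodule.top_ne_ideal_smul_of_le_jacobson_annihilator
        (maximalIdeal_le_jacobson _)).symm
    obtain ⟨rs, hlen, hrs, hreg⟩ := ModuleCat.exists_isRegular_of_exists_subsingleton_ext
      (maximalIdeal R) (y :: ys).length M hlt (ModuleCat.of R (R ⧸ maximalIdeal R))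
      (by rw [Module.support_eq_zeroLocus, Ideal.annihilator_quotient]) hext
    have hy : IsSMulRegular M y := by
      by_contra hy
      have : y ∈ ⋃ p ∈ associatedPrimes R M, (p : Set R) := by
        rw [biUnion_associatedPrimes_eq_compl_regular]
        exact hy
      obtain ⟨p, hp, hyp⟩ := Set.mem_iUnion₂.1 this
      have hp : IsAssociatedPrime p M := hp
      -- The depth gives dim R/p ≥ length of `ys` plus one. But if y ∈ p, then `ys` alone is primary
      -- to the maximal ideal modulo p, so dim R/p is at most the length of `ys`.
      have h1 := length_le_ringKrullDim_quotient_of_isAssociatedPrime rs hrs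
        hreg.toIsWeaklyRegular hp
      have h2 := ringKrullDim_quotient_le_length hp.isPrime ys
        (fun r hr => hmem r (by simp [hr])) (hrad.trans (Ideal.radical_mono ?_))
      · rw [hlen, List.length_cons] at h1
        have := h1.trans h2
        norm_cast at this
        omega
      · rw [Ideal.ofList_cons]
        have hann := Submodule.annihilator_top (R := R) (M := M) ▸ hp.annihilator_le
        refine sup_le (hann.trans le_sup_left) (sup_le ?_ le_sup_right)
        rw [Ideal.span_le, Set.singleton_subset_iff]
        exact Ideal.mem_sup_left hyp
    rw [isWeaklyRegular_cons_iff]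
    have hne : Nontrivial (QuotSMulTop y M) :=
      nontrivial_quotSMulTop_of_mem_maximalIdeal M (hmem y (by simp))
    refine ⟨hy, ih (ModuleCat.of R (QuotSMulTop y M)) (fun r hr => hmem r (by simp [hr])) ?_
      (subsingleton_ext_quotSMulTop hy (by simpa using hext))⟩
    refine hrad.trans (Ideal.radical_mono ?_)
    rw [Ideal.ofList_cons]
    refine sup_le (le_sup_of_le_left fun r hr => ?_) (sup_le (le_sup_of_le_left ?_) le_sup_right)
    · rw [Module.mem_annihilator] at hr ⊢
      rintro ⟨m⟩
      change Submodule.Quotient.mk (r • m) = 0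
      rw [hr m]
      rfl
    · rw [Ideal.span_le, Set.singleton_subset_iff]
      refine Module.mem_annihilator.2 ?_
      rintro ⟨m⟩
      exact (Submodule.Quotient.mk_eq_zero _).2 (Submodule.smul_mem_pointwise_smul _ _ _ trivial)

end Regular

/-- In a Cohen-Macaulay local ring of dimension `d`, any `d` elements generating an ideal primary to
the maximal ideal form a regular sequence. -/
theorem IsCohenMacaulayLocal.mul_mem_span_iff {R : Type u} [CommRing R] [IsLocalRing R]
    (hCM : IsCohenMacaulayLocal R) {d : ℕ} (hdim : ringKrullDim R = (d : WithBot ℕ∞))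
    {x : Fin d → R} (hx : ∀ j, x j ∈ maximalIdeal R)
    (hrad : maximalIdeal R ≤ (Ideal.span (Set.range x)).radical) (i : Fin d) {z : R}
    (hz : x i * z ∈ Ideal.span (x '' {j | j < i})) : z ∈ Ideal.span (x '' {j | j < i}) := by
  obtain ⟨hN, rs, hrs, hreg, hlen⟩ := hCM
  have hd : rs.length = d := by
    rw [hdim] at hlen
    exact_mod_cast hlen.symm
  have hlt : maximalIdeal R • (⊤ : Submodule R R) < ⊤ :=
    lt_top_iff_ne_top.2 (Submodule.top_ne_ideal_smul_of_le_jacobson_annihilator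
      (maximalIdeal_le_jacobson _)).symm
  have hext := ModuleCat.subsingleton_ext_of_exists_isRegular (maximalIdeal R)
    (ModuleCat.of R (R ⧸ maximalIdeal R))
    (by rw [Module.support_eq_zeroLocus, Ideal.annihilator_quotient]) (ModuleCat.of R R) hlt rs
    hrs hreg
  have h := isWeaklyRegular_of_le_radical (ModuleCat.of R R) (List.ofFn x)
    (by simpa [List.mem_ofFn] using hx)
    (hrad.trans (Ideal.radical_mono (le_sup_of_le_right (by simp [Ideal.ofList, Set.range]))))
    (by simpa [hd] using hext)
  have h2 := h.regular_mod_prev i (by simp)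
  have e : Ideal.ofList ((List.ofFn x).take i) = Ideal.span (x '' {j | j < i}) := by
    refine congrArg Ideal.span (Set.ext fun a => ?_)
    simp only [List.mem_take_iff_getElem, Set.mem_image, Set.mem_ofPred_eq, List.getElem_ofFn,
      List.length_ofFn]
    constructor
    · rintro ⟨j, hj, rfl⟩
      exact ⟨⟨j, by omega⟩, Fin.lt_def.2 (by simp at hj ⊢; omega), rfl⟩
    · rintro ⟨j, hj, rfl⟩
      exact ⟨j, by have := j.2; have := Fin.lt_def.1 hj; simp; omega, rfl⟩
  rw [isSMulRegular_quotient_iff_mem_of_smul_mem] at h2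
  simp only [List.getElem_ofFn, smul_eq_mul, Ideal.mul_top, e] at h2
  exact h2 z hz

/-! ### Additivity of length, and finiteness -/

section Length

variable {R M N P : Type*} [CommRing R] [AddCommGroup M] [Module R M] [AddCommGroup N] [Module R N]
  [AddCommGroup P] [Module R P]

theorem len_eq_add_of_exact (f : N →ₗ[R] M) (g : M →ₗ[R] P) (hf : Function.Injective f)
    (hg : Function.Surjective g) (H : Function.Exact f g) (hM : IsFiniteLength R M) :
    len R M = len R N + len R P := by
  rw [len, Module.length_eq_add_of_exact f g hf hg H]
  exact ENat.toNat_add (Module.length_ne_top_iff.2 (hM.of_injective hf))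
    (Module.length_ne_top_iff.2 (hM.of_surjective hg))

theorem len_congr (e : M ≃ₗ[R] N) : len R M = len R N :=
  congrArg ENat.toNat e.length_eq

theorem len_eq_add_quotient (A : Submodule R M) (hM : IsFiniteLength R M) :
    len R M = len R A + len R (M ⧸ A) :=
  len_eq_add_of_exact A.subtype A.mkQ A.injective_subtype A.mkQ_surjective
    (LinearMap.exact_subtype_mkQ A) hM

theorem len_eq_ker_add_range (f : M →ₗ[R] N) (hM : IsFiniteLength R M) :
    len R M = len R (LinearMap.ker f) + len R (LinearMap.range f) :=
  len_eq_add_of_exact (LinearMap.ker f).subtype f.rangeRestrict (Submodule.injective_subtype _)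
    f.surjective_rangeRestrict
    (fun y => by simp [Subtype.ext_iff]) hM

theorem len_eq_add_quotient_submoduleOf {A B : Submodule R M} (h : B ≤ A)
    (hM : IsFiniteLength R M) : len R A = len R B + len R (A ⧸ B.submoduleOf A) := by
  rw [len_eq_add_quotient (B.submoduleOf A) (hM.of_injective A.injective_subtype),
    len_congr (Submodule.submoduleOfEquivOfLe h)]

theorem isFiniteLength_pi {ι : Type*} [Finite ι] (hM : IsFiniteLength R M) :
    IsFiniteLength R (ι → M) := by
  rw [isFiniteLength_iff_isNoetherian_isArtinian] at hM ⊢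
  have := hM.1
  have := hM.2
  exact ⟨inferInstance, inferInstance⟩

theorem len_pi (ι : Type*) [Fintype ι] :
    len R (ι → M) = Fintype.card ι * len R M := by
  rw [len, Module.length_pi, ENat.toNat_mul]
  simp [len]

theorem len_subsingleton [Subsingleton M] : len R M = 0 := by
  rw [len, Module.length_eq_zero]
  rfl

theorem subQuot_exact {A B : Ideal R} (h : B ≤ A) :
    ∃ f : SubQuot A B →ₗ[R] R ⧸ B, Function.Injective f ∧
      Function.Exact f (Submodule.factor h) := by
  refine ⟨Submodule.mapQ (B.submoduleOf A) B A.subtype le_rfl, ?_, ?_⟩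
  · rw [injective_iff_map_eq_zero]
    intro a ha
    obtain ⟨a, rfl⟩ := Submodule.Quotient.mk_surjective _ a
    have ha : (a : R) ∈ B := (Submodule.Quotient.mk_eq_zero B).1 ha
    exact (Submodule.Quotient.mk_eq_zero _).2 ha
  · intro y
    obtain ⟨y, rfl⟩ := Submodule.Quotient.mk_surjective _ y
    constructor
    · intro hy
      have hy : y ∈ A := (Submodule.Quotient.mk_eq_zero A).1 hy
      exact ⟨Submodule.Quotient.mk ⟨y, hy⟩, rfl⟩
    · rintro ⟨z, hz⟩
      obtain ⟨z, rfl⟩ := Submodule.Quotient.mk_surjective _ z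
      rw [← hz]
      exact (Submodule.Quotient.mk_eq_zero A).2 z.2

theorem isFiniteLength_subQuot {A B : Ideal R} (h : B ≤ A) (hB : IsFiniteLength R (R ⧸ B)) :
    IsFiniteLength R (SubQuot A B) := by
  obtain ⟨f, hf, -⟩ := subQuot_exact h
  exact hB.of_injective hf

theorem len_quotient_eq_subQuot_add {A B : Ideal R} (h : B ≤ A)
    (hB : IsFiniteLength R (R ⧸ B)) : len R (R ⧸ B) = len R (SubQuot A B) + len R (R ⧸ A) := by
  obtain ⟨f, hf, hfg⟩ := subQuot_exact h
  exact len_eq_add_of_exact f (Submodule.factor h) hf (Submodule.factor_surjective h) hfg hB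

/-- If `A : x = B`, then multiplication by `x` embeds `R / B` into `R / A`, with cokernel
`R / (A + (x))`. -/
theorem len_quotient_eq_add_of_colon {A B C : Ideal R} {x : R}
    (hcolon : ∀ z, x * z ∈ A ↔ z ∈ B) (hC : C = A ⊔ Ideal.span {x})
    (hA : IsFiniteLength R (R ⧸ A)) :
    len R (R ⧸ A) = len R (R ⧸ B) + len R (R ⧸ C) := by
  have hAC : A ≤ C := hC ▸ le_sup_left
  refine len_eq_add_of_exact
    (Submodule.mapQ B A (LinearMap.lsmul R R x) fun z hz => (hcolon z).2 hz)
    (Submodule.factor hAC) ?_ (Submodule.factor_surjective hAC) ?_ hA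
  · rw [injective_iff_map_eq_zero]
    intro a ha
    obtain ⟨a, rfl⟩ := Submodule.Quotient.mk_surjective _ a
    have ha : x * a ∈ A := (Submodule.Quotient.mk_eq_zero A).1 ha
    exact (Submodule.Quotient.mk_eq_zero B).2 ((hcolon a).1 ha)
  · intro y
    obtain ⟨y, rfl⟩ := Submodule.Quotient.mk_surjective _ y
    constructor
    · intro hy
      have hy : y ∈ C := (Submodule.Quotient.mk_eq_zero C).1 hy
      rw [hC] at hy
      obtain ⟨a, ha, b, hb, rfl⟩ := Submodule.mem_sup.1 hy
      obtain ⟨c, rfl⟩ := Ideal.mem_span_singleton.1 hb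
      refine ⟨Submodule.Quotient.mk c, ?_⟩
      refine (Submodule.Quotient.eq A).2 ?_
      simpa using ha
    · rintro ⟨z, hz⟩
      obtain ⟨z, rfl⟩ := Submodule.Quotient.mk_surjective _ z
      rw [← hz]
      refine (Submodule.Quotient.mk_eq_zero C).2 ?_
      rw [hC]
      exact Ideal.mem_sup_right (Ideal.mul_mem_right _ _ (Ideal.mem_span_singleton_self x))

end Length

theorem isFiniteLength_quotient_of_le_radical {R : Type*} [CommRing R] [IsLocalRing R]
    [IsNoetherianRing R] {A : Ideal R} (h : maximalIdeal R ≤ A.radical) :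
    IsFiniteLength R (R ⧸ A) := by
  by_cases hA : A = ⊤
  · have : Subsingleton (R ⧸ A) := Ideal.Quotient.subsingleton_iff.2 hA
    exact .of_subsingleton
  have : Nontrivial (R ⧸ A) := Ideal.Quotient.nontrivial_iff.2 hA
  have : IsLocalRing (R ⧸ A) := .of_surjective' _ Ideal.Quotient.mk_surjective
  have hloc : IsLocalHom (Ideal.Quotient.mk A) := .of_surjective _ Ideal.Quotient.mk_surjective
  have hart : IsArtinianRing (R ⧸ A) := by
    rw [isArtinianRing_iff_isNilpotent_maximalIdeal]
    obtain ⟨n, hn⟩ := Ideal.exists_pow_le_of_le_radical_of_fg h (IsNoetherian.noetherian _)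
    refine ⟨n, ?_⟩
    have hmap : maximalIdeal (R ⧸ A) = (maximalIdeal R).map (Ideal.Quotient.mk A) := by
      rw [← Ideal.map_comap_of_surjective _ Ideal.Quotient.mk_surjective (maximalIdeal (R ⧸ A)),
        IsLocalRing.maximalIdeal_comap (Ideal.Quotient.mk A)]
    rw [hmap, ← Ideal.map_pow, Ideal.zero_eq_bot, Ideal.map_eq_bot_iff_le_ker, Ideal.mk_ker]
    exact hn
  rw [isFiniteLength_iff_isNoetherian_isArtinian]
  exact ⟨inferInstance, isArtinian_of_surjective_algebraMap (R := R ⧸ A)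
    Ideal.Quotient.mk_surjective⟩

theorem IsMPrimary.le_radical_mul_pow {R : Type*} [CommRing R] [IsLocalRing R] {I₁ I₂ : Ideal R}
    (h₁ : IsMPrimary I₁) (h₂ : IsMPrimary I₂) (m n : ℕ) :
    maximalIdeal R ≤ (I₁ ^ m * I₂ ^ n).radical := by
  have h : ∀ (I : Ideal R) (k : ℕ), I.radical ≤ (I ^ k).radical := by
    intro I k
    rcases eq_or_ne k 0 with rfl | hk
    · rw [pow_zero, Ideal.one_eq_top, Ideal.radical_top]
      exact le_top
    · rw [Ideal.radical_pow I hk]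
  rw [Ideal.radical_mul, le_inf_iff]
  exact ⟨h₁.2 ▸ h I₁ m, h₂.2 ▸ h I₂ n⟩

/-- The ideal generated by the first `i` elements of `x`. -/
def initialIdeal {R : Type*} [CommRing R] {d : ℕ} (x : Fin d → R) (i : ℕ) : Ideal R :=
  Ideal.span (x '' {j | (j : ℕ) < i})

theorem initialIdeal_succ {R : Type*} [CommRing R] {d : ℕ} (x : Fin d → R) (i : Fin d) :
    initialIdeal x (i + 1) = initialIdeal x i ⊔ Ideal.span {x i} := by
  rw [initialIdeal, initialIdeal, ← Ideal.span_union, ← Set.image_singleton, ← Set.image_union]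
  congr 2
  ext j
  simp only [Set.mem_ofPred_eq, Set.mem_union, Set.mem_singleton_iff, Fin.ext_iff]
  omega

theorem initialIdeal_zero {R : Type*} [CommRing R] {d : ℕ} (x : Fin d → R) :
    initialIdeal x 0 = ⊥ := by
  simp [initialIdeal]

theorem initialIdeal_self {R : Type*} [CommRing R] {d : ℕ} (x : Fin d → R) :
    initialIdeal x d = Ideal.span (Set.range x) := by
  rw [initialIdeal, ← Set.image_univ]
  congr 2
  ext j
  simp

/-! ### Superficial sequences and the stable value of the d-th difference -/

section Superficial

variable {R : Type*} [CommRing R] {I₁ I₂ : Ideal R} {d : ℕ} {x : Fin d → R}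

/-- Modulo the earlier elements, superficiality puts xᵢz into xᵢI₁ˢI₂ʳ, and regularity allows xᵢ to
be cancelled. -/
theorem IsSuperficialSequence.exists_colon (hsup : IsSuperficialSequence I₂ I₁ x)
    (hx : ∀ j, x j ∈ I₂) (i : Fin d)
    (hreg : ∀ z, x i * z ∈ initialIdeal x i → z ∈ initialIdeal x i) (s : ℕ) :
    ∃ r₀ : ℕ, ∀ r, r₀ ≤ r → ∀ z,
      x i * z ∈ I₁ ^ s * I₂ ^ (r + 1) ⊔ initialIdeal x i ↔
        z ∈ I₁ ^ s * I₂ ^ r ⊔ initialIdeal x i := by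
  obtain ⟨-, r₀, -, h⟩ := hsup i
  refine ⟨r₀, fun r hr z => ⟨fun hz => ?_, fun hz => ?_⟩⟩
  · have h := h (r + 1) s (by omega)
    change Ideal.span {Ideal.Quotient.mk (initialIdeal x i) (x i)} ⊓
      ((I₁.map (Ideal.Quotient.mk (initialIdeal x i))) ^ s *
        (I₂.map (Ideal.Quotient.mk (initialIdeal x i))) ^ (r + 1)) =
      Ideal.span {Ideal.Quotient.mk (initialIdeal x i) (x i)} *
      ((I₁.map (Ideal.Quotient.mk (initialIdeal x i))) ^ s *
        (I₂.map (Ideal.Quotient.mk (initialIdeal x i))) ^ r) at h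
    rw [← Ideal.map_pow, ← Ideal.map_pow, ← Ideal.map_pow, ← Ideal.map_mul, ← Ideal.map_mul] at h
    have hmem : Ideal.Quotient.mk (initialIdeal x i) (x i * z) ∈
        Ideal.span {Ideal.Quotient.mk (initialIdeal x i) (x i)} ⊓
          (I₁ ^ s * I₂ ^ (r + 1)).map (Ideal.Quotient.mk (initialIdeal x i)) := by
      refine ⟨?_, ?_⟩
      · rw [map_mul]
        exact Ideal.mul_mem_right _ _ (Ideal.mem_span_singleton_self _)
      · obtain ⟨a, ha, b, hb, hab⟩ := Submodule.mem_sup.1 hz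
        rw [← hab, map_add, Ideal.Quotient.eq_zero_iff_mem.2 hb, add_zero]
        exact Ideal.mem_map_of_mem _ ha
    rw [h, Ideal.mem_span_singleton_mul] at hmem
    obtain ⟨w, hw, hwz⟩ := hmem
    obtain ⟨w, hw', rfl⟩ := (Ideal.mem_map_iff_of_surjective _ Ideal.Quotient.mk_surjective).1 hw
    rw [← map_mul, eq_comm, Ideal.Quotient.eq, ← mul_sub] at hwz
    rw [← sub_add_cancel z w, add_comm]
    exact Submodule.add_mem_sup hw' (hreg _ hwz)
  · obtain ⟨a, ha, b, hb, rfl⟩ := Submodule.mem_sup.1 hz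
    rw [mul_add, pow_succ', mul_left_comm]
    exact Submodule.add_mem_sup (Ideal.mul_mem_mul (hx i) ha) (Ideal.mul_mem_left _ _ hb)

/-- By the colon formula, multiplication by the next element turns a difference of lengths into the
length modulo that element. After d steps I₂ⁿ ⊆ (x) for large n, so only R/(x) is left. The case s =
1 serves the Hilbert function, s = 0 the multiplicity. -/
theorem eventually_bdiff_iterate_len (hsup : IsSuperficialSequence I₂ I₁ x)
    (hx : ∀ j, x j ∈ I₂) (s : ℕ) (hfin : ∀ n, IsFiniteLength R (R ⧸ I₁ ^ s * I₂ ^ n))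
    (hreg : ∀ (i : Fin d) z, x i * z ∈ initialIdeal x i → z ∈ initialIdeal x i)
    (hpow : ∃ n, I₂ ^ n ≤ Ideal.span (Set.range x)) :
    ∀ᶠ n : ℤ in atTop, bdiff^[d] (fun n => (len R (R ⧸ I₁ ^ s * I₂ ^ n.toNat) : ℤ)) n =
      len R (R ⧸ Ideal.span (Set.range x)) := by
  let L : ℕ → ℤ → ℤ := fun i n => len R (R ⧸ (I₁ ^ s * I₂ ^ n.toNat ⊔ initialIdeal x i))
  have hstep : ∀ i < d, bdiff (L i) =ᶠ[atTop] L (i + 1) := by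
    intro i hi
    obtain ⟨r₀, hr⟩ := hsup.exists_colon hx ⟨i, hi⟩ (hreg ⟨i, hi⟩) s
    filter_upwards [eventually_ge_atTop ((r₀ : ℤ) + 1)] with n hn
    obtain ⟨m, rfl⟩ : ∃ m : ℕ, n = m + 1 := ⟨(n - 1).toNat, by omega⟩
    have := len_quotient_eq_add_of_colon (hr m (by omega))
      (C := I₁ ^ s * I₂ ^ (m + 1) ⊔ initialIdeal x (i + 1))
      (by rw [sup_assoc]; exact congrArg _ (initialIdeal_succ x ⟨i, hi⟩))
      ((hfin (m + 1)).of_surjective (Submodule.factor_surjective le_sup_left))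
    simp only [bdiff, L, add_sub_cancel_right, Int.toNat_natCast_add_one, Int.toNat_natCast]
    push_cast [this]
    ring
  have hiter : ∀ i ≤ d, bdiff^[i] (L 0) =ᶠ[atTop] L i := by
    intro i
    induction i with
    | zero => intro _; rfl
    | succ i ih =>
      intro hi
      rw [Function.iterate_succ_apply']
      exact (bdiff_congr (ih (by omega))).trans (hstep i (by omega))
  obtain ⟨k, hk⟩ := hpow
  have h0 : L 0 = fun n : ℤ => (len R (R ⧸ I₁ ^ s * I₂ ^ n.toNat) : ℤ) := by
    funext n
    simp only [L]
    rw [initialIdeal_zero, sup_bot_eq]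
  rw [← h0]
  filter_upwards [hiter d le_rfl, eventually_ge_atTop (k : ℤ)] with n hn hkn
  rw [hn]
  simp only [L]
  rw [initialIdeal_self, sup_eq_right.2]
  exact Ideal.mul_le_right.trans
    ((Ideal.pow_le_pow_right (m := k) (n := n.toNat) (by omega)).trans hk)

end Superficial

/-! ### Relations on a regular sequence -/

/-- The first Koszul homology of a regular sequence vanishes: every relation between its elements
is a combination of the trivial ones. -/
theorem exists_antisymm_of_sum_mul_eq_zero {R : Type*} [CommRing R] {d : ℕ} {x : Fin d → R}
    (hreg : ∀ (i : Fin d) z, x i * z ∈ initialIdeal x i → z ∈ initialIdeal x i)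
    (i : ℕ) (hi : i ≤ d) (s : Fin d → R) (hs : ∀ j : Fin d, i ≤ (j : ℕ) → s j = 0)
    (hsum : ∑ j, x j * s j = 0) :
    ∃ a : Fin d → Fin d → R, (∀ j, a j j = 0) ∧ (∀ j l, a j l = - a l j) ∧
      ∀ j, s j = ∑ l, x l * a l j := by
  induction i generalizing s with
  | zero => exact ⟨0, by simp, by simp, fun j => by simp [hs j (Nat.zero_le _)]⟩
  | succ i ih =>
    let p : Fin d := ⟨i, hi⟩
    have hmem : s p ∈ initialIdeal x i := by
      refine hreg p _ ?_
      rw [← Finset.add_sum_erase _ _ (Finset.mem_univ p)] at hsum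
      rw [eq_neg_of_add_eq_zero_left hsum]
      refine neg_mem (sum_mem fun j hj => ?_)
      rcases lt_or_ge (j : ℕ) i with hji | hji
      · exact Ideal.mul_mem_right _ _ (Ideal.subset_span ⟨j, hji, rfl⟩)
      · have : j ≠ p := Finset.ne_of_mem_erase hj
        rw [hs j (by have : (j : ℕ) ≠ i := fun h => this (Fin.ext h)
                     omega), mul_zero]
        exact zero_mem _
    obtain ⟨b, hb, hsp⟩ : ∃ b : Fin d → R, (∀ j : Fin d, i ≤ (j : ℕ) → b j = 0) ∧
        s p = ∑ j, x j * b j := by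
      rw [initialIdeal] at hmem
      refine Submodule.span_induction (p := fun y _ => ∃ b : Fin d → R,
        (∀ j : Fin d, i ≤ (j : ℕ) → b j = 0) ∧ y = ∑ j, x j * b j) ?_ ?_ ?_ ?_ hmem
      · rintro _ ⟨j, hj, rfl⟩
        refine ⟨Pi.single j 1, fun l hl => ?_, ?_⟩
        · exact Pi.single_eq_of_ne (by rintro rfl; exact absurd hj (not_lt.2 hl)) _
        · simp [Pi.single_apply]
      · exact ⟨0, by simp, by simp⟩
      · rintro _ _ - - ⟨b, hb, rfl⟩ ⟨c, hc, rfl⟩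
        exact ⟨b + c, fun j hj => by simp [hb j hj, hc j hj],
          by simp [mul_add, Finset.sum_add_distrib]⟩
      · rintro r _ - ⟨b, hb, rfl⟩
        exact ⟨r • b, fun j hj => by simp [hb j hj],
          by simp [Finset.mul_sum, mul_left_comm]⟩
    have hbp : b p = 0 := hb p le_rfl
    -- Since s_p = Σ xⱼbⱼ with b supported below i, adding trivial relations between x_p and the
    -- earlier xⱼ moves the p-th coefficient onto earlier ones: `s'` is again a relation, supported
    -- below i.
    let s' : Fin d → R := fun j => if j = p then 0 else s j + x p * b j
    have hs' : ∀ j, s' j = s j + x p * b j - (if j = p then s p else 0) := by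
      intro j
      by_cases h : j = p
      · simp [s', h, hbp]
      · simp [s', h]
    obtain ⟨a, ha0, ha, has⟩ := ih (Nat.le_of_succ_le hi) s' (fun j hj => by
        by_cases h : j = p
        · simp [s', h]
        · have hne : (j : ℕ) ≠ i := fun h' => h (Fin.ext h')
          simp [s', h, hb j hj, hs j (by omega)]) (by
        simp only [hs', mul_sub, mul_add, Finset.sum_add_distrib, Finset.sum_sub_distrib, hsum]
        simp [mul_left_comm _ (x p), ← Finset.mul_sum, ← hsp])
    refine ⟨fun l j => a l j + (if j = p then b l else 0) - (if l = p then b j else 0), ?_, ?_, ?_⟩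
    · intro j
      simp [ha0]
    · intro j l
      simp only [ha j l]
      ring
    · intro j
      simp only [mul_sub, mul_add, Finset.sum_add_distrib, Finset.sum_sub_distrib, ← has, hs']
      by_cases h : j = p
      · simp [h, hbp, ← hsp]
      · simp [h]

/-! ### Euler characteristic and low-degree homology of the complex -/

section Complex

variable {R : Type*} [CommRing R] {I₁ I₂ : Ideal R} {d : ℕ}

theorem card_idx (d i : ℕ) : Fintype.card (Idx d i) = d.choose i := by
  rw [Fintype.card_finset_len, Fintype.card_fin]

theorem isFiniteLength_cMod (hfin : ∀ n, IsFiniteLength R (R ⧸ I₁ * I₂ ^ n)) (n : ℤ) (i : ℕ) :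
    IsFiniteLength R (CMod I₁ I₂ d n i) :=
  isFiniteLength_pi (hfin _)

theorem isFiniteLength_cHomology (x : Fin d → R) (hx : ∀ j, x j ∈ I₂)
    (hfin : ∀ n, IsFiniteLength R (R ⧸ I₁ * I₂ ^ n)) (n : ℤ) (i : ℕ) :
    IsFiniteLength R (CHomology I₁ x hx n i) :=
  ((isFiniteLength_cMod hfin n i).of_injective (Submodule.injective_subtype _)).of_surjective
    (Submodule.mkQ_surjective _)

theorem len_cycles_eq (x : Fin d → R) (hx : ∀ j, x j ∈ I₂)
    (hfin : ∀ n, IsFiniteLength R (R ⧸ I₁ * I₂ ^ n)) (n : ℤ) (i : ℕ) :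
    len R (cycles I₁ x hx n i) = len R (boundaries I₁ x hx n i) + hC I₁ x hx n i :=
  len_eq_add_quotient_submoduleOf (boundaries_le_cycles x hx n i) (isFiniteLength_cMod hfin n i)

/-- For a truncated complex, the alternating sums of lengths of terms and of homology differ by the
boundaries coming from the first omitted degree. -/
theorem sum_len_cMod (x : Fin d → R) (hx : ∀ j, x j ∈ I₂)
    (hfin : ∀ n, IsFiniteLength R (R ⧸ I₁ * I₂ ^ n)) (n : ℤ) (m : ℕ) :
    ∑ i ∈ Finset.range (m + 1), (-1) ^ i * (len R (CMod I₁ I₂ d n i) : ℤ) =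
      ∑ i ∈ Finset.range (m + 1), (-1) ^ i * (hC I₁ x hx n i : ℤ) +
        (-1) ^ m * (len R (boundaries I₁ x hx n m) : ℤ) := by
  induction m with
  | zero =>
    have h1 := len_cycles_eq x hx hfin n 0
    have h2 : len R (cycles I₁ x hx n 0) = len R (CMod I₁ I₂ d n 0) :=
      len_congr Submodule.topEquiv
    simp only [zero_add, Finset.sum_range_one, pow_zero, one_mul, ← h2, h1]
    push_cast
    ring
  | succ m ih =>
    rw [Finset.sum_range_succ, ih, Finset.sum_range_succ _ (m + 1)]
    have h1 := len_eq_ker_add_range (cDiff I₁ x hx n m) (isFiniteLength_cMod hfin n (m + 1))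
    have h2 := len_cycles_eq x hx hfin n (m + 1)
    change len R (CMod I₁ I₂ d n (m + 1)) =
      len R (cycles I₁ x hx n (m + 1)) + len R (boundaries I₁ x hx n m) at h1
    rw [h1, h2]
    push_cast
    ring

/-- The binomial weights in the expansion of the d-th difference are the ranks in the Koszul
complex. -/
theorem euler_characteristic (x : Fin d → R) (hx : ∀ j, x j ∈ I₂)
    (hfin : ∀ n, IsFiniteLength R (R ⧸ I₁ * I₂ ^ n)) (n : ℤ) :
    bdiff^[d] (fun n => (len R (R ⧸ filt I₁ I₂ n) : ℤ)) n =
      ∑ i ∈ Finset.range (d + 1), (-1) ^ i * (hC I₁ x hx n i : ℤ) := by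
  have h := sum_len_cMod x hx hfin n d
  have h0 : len R (boundaries I₁ x hx n d) = 0 := by
    have : IsEmpty (Idx d (d + 1)) := by
      rw [← Fintype.card_eq_zero_iff, card_idx, Nat.choose_succ_self]
    have : Subsingleton (boundaries I₁ x hx n d) := by
      refine ⟨?_⟩
      rintro ⟨_, a, rfl⟩ ⟨_, b, rfl⟩
      rw [Subsingleton.elim a b]
    exact len_subsingleton
  rw [h0, Nat.cast_zero, mul_zero, add_zero] at h
  rw [← h, bdiff_iterate_eq_sum]
  refine Finset.sum_congr rfl fun i _ => ?_
  rw [len_pi, card_idx]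
  push_cast
  ring

/-- The index `∅`. -/
def Idx.empty (d : ℕ) : Idx d 0 := ⟨∅, rfl⟩

instance (d : ℕ) : Unique (Idx d 0) where
  default := Idx.empty d
  uniq s := Subtype.ext (Finset.card_eq_zero.1 s.2)

/-- The index `{j}`. -/
def Idx.single (j : Fin d) : Idx d 1 := ⟨{j}, Finset.card_singleton j⟩

theorem Idx.exists_eq_single (s : Idx d 1) : ∃ j, s = Idx.single j := by
  obtain ⟨j, hj⟩ := Finset.card_eq_one.1 s.2
  exact ⟨j, Subtype.ext hj⟩

theorem Idx.single_injective : Function.Injective (Idx.single (d := d)) := fun _ _ h =>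
  Finset.singleton_injective (congrArg Subtype.val h)

theorem cDiff_zero_apply_mk (x : Fin d → R) (hx : ∀ j, x j ∈ I₂) (n : ℤ)
    (r : Idx d 1 → R) (t : Idx d 0) :
    cDiff I₁ x hx n 0 (fun s => Submodule.Quotient.mk (r s)) t =
      Submodule.Quotient.mk (∑ j, x j * r (Idx.single j)) := by
  obtain rfl : t = Idx.empty d := Subsingleton.elim _ _
  rw [cDiff_apply_mk]
  congr 1
  have : ∀ j : Fin d, j ∉ (Idx.empty d).1 := fun j => Finset.notMem_empty j
  refine (Finset.sum_subtype Finset.univ (fun j => by simp [this j])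
    (fun j => sgn R (Idx.empty d).1 j * (x j * r (Idx.single j)))).symm.trans ?_
  refine Finset.sum_congr rfl fun j _ => ?_
  simp [sgn, Idx.empty]

theorem len_quotient_boundaries_zero (x : Fin d → R) (hx : ∀ j, x j ∈ I₂)
    (hfin : ∀ n, IsFiniteLength R (R ⧸ I₁ * I₂ ^ n)) (n : ℤ) :
    len R (R ⧸ filt I₁ I₂ n) = len R (boundaries I₁ x hx n 0) +
      len R (R ⧸ filt I₁ I₂ n ⊔ Ideal.span (Set.range x)) := by
  have e : filt I₁ I₂ (n - ((0 : ℕ) : ℤ)) = filt I₁ I₂ n := by simp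
  have hle : filt I₁ I₂ (n - ((0 : ℕ) : ℤ)) ≤ filt I₁ I₂ n ⊔ Ideal.span (Set.range x) :=
    e.le.trans le_sup_left
  have hlen : len R (CMod I₁ I₂ d n 0) = len R (R ⧸ filt I₁ I₂ n) := by
    rw [len_pi, Fintype.card_unique, one_mul, e]
  rw [← hlen]
  refine len_eq_add_of_exact (boundaries I₁ x hx n 0).subtype
    (Submodule.factor hle ∘ₗ LinearMap.proj (Idx.empty d)) (Submodule.injective_subtype _) ?_ ?_
    (isFiniteLength_cMod hfin n 0)
  · exact (Submodule.factor_surjective hle).comp (Function.surjective_eval _)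
  · intro f
    obtain ⟨r, hr⟩ := Submodule.Quotient.mk_surjective _ (f (Idx.empty d))
    have hf : f = fun _ => Submodule.Quotient.mk r := by
      funext t
      obtain rfl : t = Idx.empty d := Subsingleton.elim _ _
      exact hr.symm
    subst hf
    constructor
    · intro h
      have h : r ∈ filt I₁ I₂ n ⊔ Ideal.span (Set.range x) :=
        (Submodule.Quotient.mk_eq_zero _).1 h
      obtain ⟨a, ha, b, hb, rfl⟩ := Submodule.mem_sup.1 h
      obtain ⟨c, rfl⟩ := (Ideal.mem_span_range_iff_exists_fun).1 hb
      choose k hk using Idx.exists_eq_single (d := d)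
      refine ⟨⟨_, (fun s => Submodule.Quotient.mk (c (k s))), rfl⟩, ?_⟩
      funext t
      refine (cDiff_zero_apply_mk x hx n (fun s => c (k s)) t).trans ?_
      refine (Submodule.Quotient.eq _).2 ?_
      have hk' : ∀ j, k (Idx.single j) = j := fun j =>
        (Idx.single_injective (hk (Idx.single j))).symm
      rw [e]
      have : ∑ j, x j * c (k (Idx.single j)) - (a + ∑ j, c j * x j) = -a := by
        simp only [hk', mul_comm]
        ring
      rw [this]
      exact neg_mem ha
    · rintro ⟨⟨_, g, rfl⟩, hg⟩
      choose c hc using fun s => Submodule.Quotient.mk_surjective _ (g s)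
      obtain rfl : (fun s => Submodule.Quotient.mk (c s)) = g := funext hc
      have h2 := (cDiff_zero_apply_mk x hx n c (Idx.empty d)).symm.trans
        (congrFun hg (Idx.empty d))
      have h3 := (Submodule.Quotient.eq _).1 h2
      refine (Submodule.Quotient.mk_eq_zero _).2 ?_
      rw [← sub_sub_cancel (∑ j, x j * c (Idx.single j)) r]
      refine sub_mem (Ideal.mem_sup_right (sum_mem fun j _ => ?_)) (hle h3)
      exact Ideal.mul_mem_right _ _ (Ideal.subset_span ⟨j, rfl⟩)

theorem hC_zero (x : Fin d → R) (hx : ∀ j, x j ∈ I₂)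
    (hfin : ∀ n, IsFiniteLength R (R ⧸ I₁ * I₂ ^ n)) (n : ℤ) :
    hC I₁ x hx n 0 = len R (R ⧸ filt I₁ I₂ n ⊔ Ideal.span (Set.range x)) := by
  have h1 := len_cycles_eq x hx hfin n 0
  have h2 : len R (cycles I₁ x hx n 0) = len R (CMod I₁ I₂ d n 0) :=
    len_congr Submodule.topEquiv
  have h3 := len_quotient_boundaries_zero x hx hfin n
  have h4 : len R (CMod I₁ I₂ d n 0) = len R (R ⧸ filt I₁ I₂ n) := by
    rw [len_pi, Fintype.card_unique, one_mul, Nat.cast_zero, sub_zero]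
  omega

theorem sum_mul_koszul_eq_zero (x : Fin d → R) (c : Idx d 2 → R) :
    ∑ j, x j * ∑ l : {l : Fin d // l ∉ (Idx.single j).1},
      sgn R (Idx.single j).1 l.1 * (x l.1 * c ((Idx.single j).insert l)) = 0 := by
  -- With I₁ = ⊥ and I₂ = ⊤ every quotient in the complex is R/⊥, so d² = 0 becomes an identity in
  -- R.
  have hx : ∀ j, x j ∈ (⊤ : Ideal R) := fun _ => trivial
  have h := congrFun (cDiff_cDiff (I₁ := ⊥) x hx 0 0 fun s => Submodule.Quotient.mk (c s))
    (Idx.empty d)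
  rw [show cDiff ⊥ x hx 0 1 (fun s => Submodule.Quotient.mk (c s)) = _ from
    funext fun t => cDiff_apply_mk x hx 0 1 c t] at h
  have h := (Submodule.Quotient.mk_eq_zero _).1 ((cDiff_zero_apply_mk x hx 0 _ _).symm.trans h)
  simpa [filt] using h

/-- The map `(R / A) ^ d → R / Q A`, `r ↦ ∑ x_j r_j`, where `Q = (x)`. -/
noncomputable def relMap (x : Fin d → R) (A : Ideal R) :
    (Idx d 1 → R ⧸ A) →ₗ[R] R ⧸ Ideal.span (Set.range x) * A :=
  ∑ j, Submodule.mapQ A (Ideal.span (Set.range x) * A) (LinearMap.lsmul R R (x j))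
    (fun _ ha => Ideal.mul_mem_mul (Ideal.subset_span ⟨j, rfl⟩) ha) ∘ₗ
      LinearMap.proj (Idx.single j)

theorem relMap_apply_mk (x : Fin d → R) (A : Ideal R) (r : Idx d 1 → R) :
    relMap x A (fun s => Submodule.Quotient.mk (r s)) =
      Submodule.Quotient.mk (∑ j, x j * r (Idx.single j)) := by
  have h := map_sum (Submodule.mkQ (Ideal.span (Set.range x) * A))
    (fun j => x j * r (Idx.single j)) Finset.univ
  simp only [Submodule.mkQ_apply] at h
  rw [h, relMap, LinearMap.sum_apply]
  rfl

/-- Let A be the ideal by which degree 1 is divided. If Σ xⱼrⱼ ∈ (x)A, subtracting suitable aⱼ ∈ A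
from the rⱼ gives a true relation, which is a Koszul boundary by regularity. Thus the degree-1
boundaries are the kernel of a map onto (x)/(x)A, which determines their length. -/
theorem ker_relMap {x : Fin d → R} (hx : ∀ j, x j ∈ I₂)
    (hreg : ∀ (i : Fin d) z, x i * z ∈ initialIdeal x i → z ∈ initialIdeal x i) (n : ℤ) :
    LinearMap.ker (relMap x (filt I₁ I₂ (n - ((1 : ℕ) : ℤ)))) = boundaries I₁ x hx n 1 := by
  ext f
  constructor
  · intro hf
    choose r hr using fun s => Submodule.Quotient.mk_surjective _ (f s)
    obtain rfl : (fun s => Submodule.Quotient.mk (r s)) = f := funext hr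
    have hf := (Submodule.Quotient.mk_eq_zero _).1 ((relMap_apply_mk x _ r).symm.trans hf)
    rw [mul_comm, ← smul_eq_mul, Ideal.span, Submodule.mem_ideal_smul_span_iff_exists_sum] at hf
    obtain ⟨a, ha, hsum⟩ := hf
    rw [Finsupp.sum_fintype _ _ (by simp)] at hsum
    obtain ⟨b, hb0, hb, hbs⟩ := exists_antisymm_of_sum_mul_eq_zero hreg d le_rfl
      (fun j => r (Idx.single j) - a j) (fun j hj => absurd j.2 (not_lt.2 hj))
      (by
        simp only [mul_sub, Finset.sum_sub_distrib, ← hsum, smul_eq_mul, mul_comm]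
        exact sub_self _)
    -- On u = {p, q} with p < q the double sum is just `b p q`; antisymmetry of `b` accounts for the
    -- Koszul sign.
    refine ⟨fun u => Submodule.Quotient.mk
      (∑ p ∈ u.1, ∑ q ∈ u.1, if p < q then b p q else 0), ?_⟩
    funext t
    obtain ⟨j, rfl⟩ := Idx.exists_eq_single t
    refine (cDiff_apply_mk x hx n 1 _ _).trans ?_
    refine (Submodule.Quotient.eq _).2 ?_
    have key : ∑ l : {l : Fin d // l ∉ (Idx.single j).1}, sgn R (Idx.single j).1 l.1 *
        (x l.1 * ∑ p ∈ ((Idx.single j).insert l).1, ∑ q ∈ ((Idx.single j).insert l).1,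
          if p < q then b p q else 0) = r (Idx.single j) - a j := by
      rw [hbs j, ← Finset.add_sum_erase _ _ (Finset.mem_univ j), hb0, mul_zero, zero_add]
      rw [Finset.sum_subtype (p := fun l => l ∉ (Idx.single j).1) (Finset.univ.erase j)
        (fun l => by simp [Idx.single])]
      refine Finset.sum_congr rfl fun l _ => ?_
      obtain ⟨l, hl⟩ := l
      have hlj : l ∉ ({j} : Finset (Fin d)) := hl
      have hne : l ≠ j := by simpa using hlj
      simp only [Idx.insert, Idx.single, Finset.sum_insert hlj, Finset.sum_singleton, lt_irrefl,
        if_false, zero_add, add_zero, sgn]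
      rcases lt_or_gt_of_ne hne with h | h
      · simp [Finset.filter_singleton, h, h.asymm]
      · simp [Finset.filter_singleton, h, h.asymm, hb l j]
    rw [key, sub_sub_cancel_left]
    exact neg_mem (ha j)
  · rintro ⟨g, rfl⟩
    choose c hc using fun s => Submodule.Quotient.mk_surjective _ (g s)
    obtain rfl : (fun s => Submodule.Quotient.mk (c s)) = g := funext hc
    rw [show cDiff I₁ x hx n 1 (fun s => Submodule.Quotient.mk (c s)) = _ from
      funext fun t => cDiff_apply_mk x hx n 1 c t]
    refine (relMap_apply_mk x _ _).trans ?_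
    rw [sum_mul_koszul_eq_zero x c, Submodule.Quotient.mk_zero]

theorem len_quotient_span_mul {x : Fin d → R} {A : Ideal R}
    (hA : IsFiniteLength R (R ⧸ Ideal.span (Set.range x) * A)) :
    len R (R ⧸ Ideal.span (Set.range x) * A) =
      len R (LinearMap.range (relMap x A)) + len R (R ⧸ Ideal.span (Set.range x)) := by
  refine len_eq_add_of_exact (LinearMap.range (relMap x A)).subtype
    (Submodule.factor Ideal.mul_le_left) (Submodule.injective_subtype _)
    (Submodule.factor_surjective _) ?_ hA
  intro y
  obtain ⟨y, rfl⟩ := Submodule.Quotient.mk_surjective _ y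
  constructor
  · intro hy
    have hy : y ∈ Ideal.span (Set.range x) := (Submodule.Quotient.mk_eq_zero _).1 hy
    obtain ⟨c, rfl⟩ := (Ideal.mem_span_range_iff_exists_fun).1 hy
    choose k hk using Idx.exists_eq_single (d := d)
    refine ⟨⟨_, (fun s => Submodule.Quotient.mk (c (k s))), rfl⟩, ?_⟩
    refine (relMap_apply_mk x A fun s => c (k s)).trans (congrArg _ ?_)
    exact Finset.sum_congr rfl fun j _ => by
      rw [← Idx.single_injective (hk (Idx.single j)), mul_comm]
  · rintro ⟨⟨_, g, rfl⟩, hg⟩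
    choose c hc using fun s => Submodule.Quotient.mk_surjective _ (g s)
    obtain rfl : (fun s => Submodule.Quotient.mk (c s)) = g := funext hc
    rw [← hg]
    have hmem : ∑ j, x j * c (Idx.single j) ∈ Ideal.span (Set.range x) :=
      sum_mem fun j _ => Ideal.mul_mem_right _ _ (Ideal.subset_span ⟨j, rfl⟩)
    exact (congrArg (Submodule.factor _) (relMap_apply_mk x A c)).trans
      ((Submodule.Quotient.mk_eq_zero _).2 hmem)

/-- Degree-1 boundaries and cycles are kernels of maps on the same module, with images (x)/(x)A and
((x) + A')/A', where A and A' are the filtration ideals at n - 1 and n. So h₁ is a difference of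
image lengths, written here without subtraction. -/
theorem hC_one {x : Fin d → R} (hx : ∀ j, x j ∈ I₂)
    (hfin : ∀ n, IsFiniteLength R (R ⧸ I₁ * I₂ ^ n))
    (hreg : ∀ (i : Fin d) z, x i * z ∈ initialIdeal x i → z ∈ initialIdeal x i) (n : ℤ)
    (hA : IsFiniteLength R (R ⧸ Ideal.span (Set.range x) * filt I₁ I₂ (n - 1))) :
    hC I₁ x hx n 1 + len R (R ⧸ Ideal.span (Set.range x)) + len R (R ⧸ filt I₁ I₂ n) =
      len R (R ⧸ Ideal.span (Set.range x) * filt I₁ I₂ (n - 1)) +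
        len R (R ⧸ filt I₁ I₂ n ⊔ Ideal.span (Set.range x)) := by
  have h1 := len_cycles_eq x hx hfin n 1
  have h2 : len R (CMod I₁ I₂ d n 1) =
      len R (cycles I₁ x hx n 1) + len R (boundaries I₁ x hx n 0) :=
    len_eq_ker_add_range (cDiff I₁ x hx n 0) (isFiniteLength_cMod hfin n 1)
  have h3 := len_quotient_boundaries_zero x hx hfin n
  have h4 := len_quotient_span_mul hA
  have h5 : len R (CMod I₁ I₂ d n 1) = len R (boundaries I₁ x hx n 1) +
      len R (LinearMap.range (relMap x (filt I₁ I₂ (n - 1)))) := by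
    rw [← ker_relMap hx hreg]
    exact len_eq_ker_add_range (relMap x (filt I₁ I₂ (n - ((1 : ℕ) : ℤ))))
      (isFiniteLength_cMod hfin n 1)
  omega

end Complex

/-! ### Coefficients as sums of differences -/

theorem hpoly_leadingCoeff {d : ℕ} {f : ℤ → ℤ} {c : ℤ} {g : ℕ → ℤ}
    (hc : ∀ᶠ n in atTop, bdiff^[d] f n = c) (hg : f =ᶠ[atTop] hpoly d g) : g 0 = c := by
  have h := bdiff_iterate_hpoly d 0 g
  rw [zero_add] at h
  obtain ⟨n, h1, h2⟩ := (hc.and (bdiff_iterate_congr hg d)).exists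
  rw [← h1, h2, h, hpoly_zero]

theorem hasSum_hilbertCoeff {d : ℕ} {f : ℤ → ℤ} {c : ℤ} {g : ℕ → ℤ} (hf : ∀ n ≤ 0, f n = f 0)
    (hc : ∀ᶠ n in atTop, bdiff^[d] f n = c) (hg : f =ᶠ[atTop] hpoly d g) {i : ℕ} (hi : 1 ≤ i)
    (hid : i ≤ d) :
    HasSum (fun n : Set.Ici (i - 1) =>
        (((n : ℕ).choose (i - 1) : ℕ) : ℤ) * (c - bdiff^[d] f ((n : ℕ) + 1)))
      (g i - (-1) ^ d * (if i = d then f 0 else 0)) := by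
  obtain ⟨k, rfl⟩ : ∃ k, i = k + 1 := ⟨i - 1, by omega⟩
  obtain ⟨m, rfl⟩ := Nat.exists_eq_add_of_le hid
  have h0 := bdiff_iterate_hpoly (k + 1 + m) 0 g
  have hm := bdiff_iterate_hpoly m (k + 1) g
  rw [zero_add] at h0
  -- With i = k + 1 and d = i + m, taking m differences first makes gᵢ the last surviving
  -- coefficient, so that it can be read off at 0.
  have hF : bdiff^[m] (hpoly (k + 1 + m) g - f) =ᶠ[atTop] 0 := by
    rw [← bdiff_iterate_zero m]
    refine bdiff_iterate_congr ?_ m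
    filter_upwards [hg] with n hn
    simp [hn]
  have h := hasSum_choose_mul_bdiff hF k
  rw [← Function.iterate_add_apply, bdiff_iterate_sub, bdiff_iterate_sub, h0, hm] at h
  have e : ∀ n, (hpoly 0 g - bdiff^[k + 1 + m] f) n = c - bdiff^[k + 1 + m] f n := fun n => by
    rw [Pi.sub_apply, hpoly_zero, hpoly_leadingCoeff hc hg]
  simp only [e, Pi.sub_apply, hpoly_apply_zero] at h
  have e1 : (-1 : ℤ) ^ (k + 1) * (-1) ^ (k + 1) = 1 := by rw [← mul_pow]; simp
  have e2 : g (k + 1) - (-1) ^ (k + 1 + m) * (if k + 1 = k + 1 + m then f 0 else 0) =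
      (-1) ^ (k + 1) * ((-1) ^ (k + 1) * g (k + 1) - bdiff^[m] f 0) := by
    rcases Nat.eq_zero_or_pos m with rfl | hm0
    · simp only [add_zero, if_true, Function.iterate_zero, id]
      linear_combination (-g (k + 1)) * e1
    · rw [if_neg (by omega), bdiff_iterate_eq_zero_of_const hf hm0.ne' le_rfl]
      linear_combination (-g (k + 1)) * e1
  rw [e2]
  exact h

/-- The extension by zero of a finite sequence of coefficients. -/
def extendCoeffs {d : ℕ} (g : Fin (d + 1) → ℤ) (j : ℕ) : ℤ :=
  if h : j < d + 1 then g ⟨j, h⟩ else 0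

theorem extendCoeffs_coe {d : ℕ} (g : Fin (d + 1) → ℤ) (j : Fin (d + 1)) :
    extendCoeffs g j = g j :=
  dif_pos j.2

theorem isHilbertCoeffs_iff {R : Type*} [CommRing R] {d : ℕ} {I₁ I₂ : Ideal R}
    {g : Fin (d + 1) → ℤ} {g' : ℕ → ℤ} (h : ∀ j : Fin (d + 1), g' j = g j) :
    IsHilbertCoeffs d I₁ I₂ g ↔
      (fun n : ℤ => (len R (R ⧸ filt I₁ I₂ n) : ℤ)) =ᶠ[atTop] hpoly d g' := by
  have key : ∀ n : ℕ, (len R (R ⧸ I₁ * I₂ ^ n) : ℤ) =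
      ∑ j : Fin (d + 1), (-1) ^ (j : ℕ) * g j *
        (((n + (d - (j : ℕ)) - 1).choose (d - (j : ℕ)) : ℕ) : ℤ) ↔
      (len R (R ⧸ filt I₁ I₂ n) : ℤ) = hpoly d g' n := by
    intro n
    rw [hpoly, Finset.sum_range]
    simp only [h, multichoose_natCast]
    rfl
  rw [IsHilbertCoeffs, EventuallyEq, eventually_atTop, eventually_atTop]
  constructor
  · rintro ⟨N, hN⟩
    refine ⟨N, fun n hn => ?_⟩
    obtain ⟨m, rfl⟩ := Int.eq_ofNat_of_zero_le (Int.le_trans (Int.natCast_nonneg N) hn)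
    exact (key m).1 (hN m (by exact_mod_cast hn))
  · rintro ⟨N, hN⟩
    exact ⟨N.toNat, fun n hn => (key n).2 (hN n (by omega))⟩

theorem hasMultiplicity_of_eventually {R : Type*} [CommRing R] {d : ℕ} {I : Ideal R} {c : ℤ}
    (h : ∀ᶠ n : ℤ in atTop, bdiff^[d] (fun n => (len R (R ⧸ I ^ n.toNat) : ℤ)) n = c) :
    HasMultiplicity d I c := by
  obtain ⟨g, hg⟩ := exists_eventuallyEq_hpoly h
  have h0 := hpoly_leadingCoeff h hg
  rw [HasMultiplicity, ← h0]
  refine (tendsto_hpoly_div_pow d g).congr' ?_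
  filter_upwards [tendsto_natCast_atTop_atTop.eventually hg] with n hn
  rw [← hn]
  simp

end FiberCone

/-! ### The main theorem -/

theorem mainTheorem2 {R : Type*} [CommRing R] [IsLocalRing R]
    (hCM : FiberCone.IsCohenMacaulayLocal R)
    (d : ℕ) (hd : 1 ≤ d) (hdim : ringKrullDim R = (d : WithBot ℕ∞))
    (I₁ I₂ : Ideal R) (hI₁ : FiberCone.IsMPrimary I₁) (hI₂ : FiberCone.IsMPrimary I₂)
    (x : Fin d → R) (hx : ∀ j, x j ∈ I₂)
    (hred : FiberCone.IsMinimalReduction (Ideal.span (Set.range x)) I₂)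
    (hsup : FiberCone.IsSuperficialSequence I₂ I₁ x) :
    -- all the lengths that occur are finite
    (∀ n : ℕ,
      IsFiniteLength R (R ⧸ I₁ * I₂ ^ n) ∧
      IsFiniteLength R (R ⧸ I₂ ^ n) ∧
      IsFiniteLength R
        (FiberCone.SubQuot (I₁ * I₂ ^ n + Ideal.span (Set.range x)) (Ideal.span (Set.range x))) ∧
      IsFiniteLength R
        (FiberCone.SubQuot (I₁ * I₂ ^ (n + 1)) (Ideal.span (Set.range x) * (I₁ * I₂ ^ n))) ∧
      ∀ j : ℕ, IsFiniteLength R (FiberCone.CHomology I₁ x hx (n : ℤ) j)) ∧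
    -- the Hilbert polynomial exists and its coefficients are well defined
    (∃! g : Fin (d + 1) → ℤ, FiberCone.IsHilbertCoeffs d I₁ I₂ g) ∧
    ∀ g : Fin (d + 1) → ℤ, FiberCone.IsHilbertCoeffs d I₁ I₂ g →
      FiberCone.HasMultiplicity d I₂ (g 0) ∧
      ∀ i : Fin (d + 1), 1 ≤ (i : ℕ) →
        -- the two sums have only finitely many nonzero terms, and
        -- each, plus `(-1) ^ d * ℓ(R / K_i)`, equals `g i`
        ∃ S₁ S₂ : ℤ,
          HasSum (fun n : Set.Ici ((i : ℕ) - 1) =>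
            (((n : ℕ).choose ((i : ℕ) - 1) : ℕ) : ℤ) *
              ((FiberCone.len R
                  (FiberCone.SubQuot (I₁ * I₂ ^ ((n : ℕ) + 1) + Ideal.span (Set.range x))
                    (Ideal.span (Set.range x))) : ℤ) -
                ∑ j ∈ Finset.Icc 1 d,
                  (-1) ^ j * (FiberCone.hC I₁ x hx (((n : ℕ) : ℤ) + 1) j : ℤ))) S₁ ∧
          HasSum (fun n : Set.Ici ((i : ℕ) - 1) =>
            (((n : ℕ).choose ((i : ℕ) - 1) : ℕ) : ℤ) *
              ((FiberCone.len R
                  (FiberCone.SubQuot (I₁ * I₂ ^ ((n : ℕ) + 1))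
                    (Ideal.span (Set.range x) * (I₁ * I₂ ^ (n : ℕ)))) : ℤ) -
                ∑ j ∈ Finset.Icc 2 d,
                  (-1) ^ j * (FiberCone.hC I₁ x hx (((n : ℕ) : ℤ) + 1) j : ℤ))) S₂ ∧
          g i = S₁ + (-1) ^ d *
            (FiberCone.len R (R ⧸ (if (i : ℕ) = d then I₁ else (⊤ : Ideal R))) : ℤ) ∧
          g i = S₂ + (-1) ^ d *
            (FiberCone.len R (R ⧸ (if (i : ℕ) = d then I₁ else (⊤ : Ideal R))) : ℤ) := by
  open FiberCone in
  have hN : IsNoetherianRing R := hCM.1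
  obtain ⟨r, hr⟩ := hred.1.2
  have hpow : I₂ ^ (r + 1) ≤ Ideal.span (Set.range x) := hr ▸ Ideal.mul_le_left
  have hQ : maximalIdeal R ≤ (Ideal.span (Set.range x)).radical := by
    rw [← hI₂.2, ← Ideal.radical_pow I₂ (Nat.succ_ne_zero r)]
    exact Ideal.radical_mono hpow
  have hfin : ∀ s n, IsFiniteLength R (R ⧸ I₁ ^ s * I₂ ^ n) := fun s n =>
    isFiniteLength_quotient_of_le_radical (hI₁.le_radical_mul_pow hI₂ s n)
  have hfin1 : ∀ n, IsFiniteLength R (R ⧸ I₁ * I₂ ^ n) := fun n => by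
    have h := hfin 1 n
    rwa [pow_one] at h
  have hfin0 : ∀ n, IsFiniteLength R (R ⧸ I₂ ^ n) := fun n => by
    have h := hfin 0 n
    rwa [pow_zero, one_mul] at h
  have hfinQ := isFiniteLength_quotient_of_le_radical hQ
  have hfinQA : ∀ n, IsFiniteLength R (R ⧸ Ideal.span (Set.range x) * (I₁ * I₂ ^ n)) := by
    intro n
    refine isFiniteLength_quotient_of_le_radical ?_
    rw [Ideal.radical_mul]
    exact le_inf hQ (by simpa using hI₁.le_radical_mul_pow hI₂ 1 n)
  have hQA : ∀ n, Ideal.span (Set.range x) * (I₁ * I₂ ^ n) ≤ I₁ * I₂ ^ (n + 1) := by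
    intro n
    rw [mul_left_comm, pow_succ']
    exact Ideal.mul_mono_right (Ideal.mul_mono_left hred.1.1)
  have hI₂m : I₂ ≤ maximalIdeal R := hI₂.2 ▸ Ideal.le_radical
  have hreg : ∀ (i : Fin d) z, x i * z ∈ initialIdeal x i → z ∈ initialIdeal x i :=
    fun i z hz => hCM.mul_mem_span_iff hdim (fun j => hI₂m (hx j)) hQ i hz
  have hc : ∀ s, ∀ᶠ n : ℤ in atTop,
      bdiff^[d] (fun n => (len R (R ⧸ I₁ ^ s * I₂ ^ n.toNat) : ℤ)) n =
        len R (R ⧸ Ideal.span (Set.range x)) := fun s =>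
    eventually_bdiff_iterate_len hsup hx s (hfin s) hreg ⟨r + 1, hpow⟩
  have hc1 : ∀ᶠ n : ℤ in atTop, bdiff^[d] (fun n => (len R (R ⧸ filt I₁ I₂ n) : ℤ)) n =
      len R (R ⧸ Ideal.span (Set.range x)) := by
    have e : (fun n : ℤ => (len R (R ⧸ filt I₁ I₂ n) : ℤ)) =
        fun n => (len R (R ⧸ I₁ ^ 1 * I₂ ^ n.toNat) : ℤ) := funext fun n => by rw [pow_one]; rfl
    rw [e]
    exact hc 1
  have hmult : HasMultiplicity d I₂ (len R (R ⧸ Ideal.span (Set.range x)) : ℕ) :=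
    hasMultiplicity_of_eventually <| by
      have e : (fun n : ℤ => (len R (R ⧸ I₂ ^ n.toNat) : ℤ)) =
          fun n => (len R (R ⧸ I₁ ^ 0 * I₂ ^ n.toNat) : ℤ) :=
        funext fun n => by rw [pow_zero, one_mul]
      rw [e]
      exact hc 0
  have hconst : ∀ n : ℤ, n ≤ 0 → (len R (R ⧸ filt I₁ I₂ n) : ℤ) = len R (R ⧸ filt I₁ I₂ 0) := by
    intro n hn
    rw [show filt I₁ I₂ n = filt I₁ I₂ 0 by simp only [filt, Int.toNat_of_nonpos hn, Int.toNat_zero]]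
  have hfirst : ∀ n : ℕ, (len R (SubQuot (I₁ * I₂ ^ (n + 1) + Ideal.span (Set.range x))
        (Ideal.span (Set.range x))) : ℤ) -
      ∑ j ∈ Finset.Icc 1 d, (-1) ^ j * (hC I₁ x hx ((n : ℤ) + 1) j : ℤ) =
      len R (R ⧸ Ideal.span (Set.range x)) -
        bdiff^[d] (fun n => (len R (R ⧸ filt I₁ I₂ n) : ℤ)) ((n : ℤ) + 1) := by
    intro n
    have h1 := len_quotient_eq_subQuot_add (A := I₁ * I₂ ^ (n + 1) + Ideal.span (Set.range x))
      le_sup_right hfinQ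
    have h2 := hC_zero x hx hfin1 ((n : ℤ) + 1)
    have h3 : len R (R ⧸ filt I₁ I₂ ((n : ℤ) + 1) ⊔ Ideal.span (Set.range x)) =
      len R (R ⧸ I₁ * I₂ ^ (n + 1) + Ideal.span (Set.range x)) := rfl
    rw [euler_characteristic x hx hfin1, Finset.range_eq_Ico, Finset.sum_eq_sum_Ico_succ_bot
      (Nat.succ_pos d), h2, h3, h1]
    push_cast
    rw [show Finset.Ico (0 + 1) (d + 1) = Finset.Icc 1 d from rfl]
    ring
  have hsecond : ∀ n : ℕ, (len R (SubQuot (I₁ * I₂ ^ (n + 1))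
        (Ideal.span (Set.range x) * (I₁ * I₂ ^ n))) : ℤ) -
      ∑ j ∈ Finset.Icc 2 d, (-1) ^ j * (hC I₁ x hx ((n : ℤ) + 1) j : ℤ) =
      len R (R ⧸ Ideal.span (Set.range x)) -
        bdiff^[d] (fun n => (len R (R ⧸ filt I₁ I₂ n) : ℤ)) ((n : ℤ) + 1) := by
    intro n
    have h1 := len_quotient_eq_subQuot_add (A := I₁ * I₂ ^ (n + 1) + Ideal.span (Set.range x))
      le_sup_right hfinQ
    have h2 := len_quotient_eq_subQuot_add (hQA n) (hfinQA n)
    have e : filt I₁ I₂ ((n : ℤ) + 1 - 1) = I₁ * I₂ ^ n := by simp [filt]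
    have h3 := hC_one hx hfin1 hreg ((n : ℤ) + 1) (by rw [e]; exact hfinQA n)
    rw [e] at h3
    have h4 : len R (R ⧸ filt I₁ I₂ ((n : ℤ) + 1) ⊔ Ideal.span (Set.range x)) =
      len R (R ⧸ I₁ * I₂ ^ (n + 1) + Ideal.span (Set.range x)) := rfl
    have h5 : len R (R ⧸ filt I₁ I₂ ((n : ℤ) + 1)) = len R (R ⧸ I₁ * I₂ ^ (n + 1)) := rfl
    rw [← hfirst n, ← Finset.Ico_add_one_right_eq_Icc 1, Finset.sum_eq_sum_Ico_succ_bot (by omega),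
      show Finset.Ico (1 + 1) (d + 1) = Finset.Icc 2 d from rfl]
    zify at h1 h2 h3 h4 h5
    linear_combination h1 - h3 - h2 - h4 + h5
  have hcoeff : ∀ g, IsHilbertCoeffs d I₁ I₂ g →
      g 0 = len R (R ⧸ Ideal.span (Set.range x)) ∧ ∀ i : Fin (d + 1), 1 ≤ (i : ℕ) →
        HasSum (fun n : Set.Ici ((i : ℕ) - 1) => (((n : ℕ).choose ((i : ℕ) - 1) : ℕ) : ℤ) *
          (len R (R ⧸ Ideal.span (Set.range x)) -
            bdiff^[d] (fun n => (len R (R ⧸ filt I₁ I₂ n) : ℤ)) ((n : ℕ) + 1)))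
          (g i - (-1) ^ d * (if (i : ℕ) = d then (len R (R ⧸ filt I₁ I₂ 0) : ℤ) else 0)) := by
    intro g hg
    have h := (isHilbertCoeffs_iff (extendCoeffs_coe g)).1 hg
    have h0 := extendCoeffs_coe g 0
    refine ⟨?_, fun i hi => ?_⟩
    · rw [← h0]
      exact hpoly_leadingCoeff hc1 h
    · rw [← extendCoeffs_coe g i]
      exact hasSum_hilbertCoeff hconst hc1 h hi (Nat.lt_succ_iff.1 i.2)
  refine ⟨fun n => ⟨hfin1 n, hfin0 n, isFiniteLength_subQuot le_sup_right hfinQ,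
    isFiniteLength_subQuot (hQA n) (hfinQA n), isFiniteLength_cHomology x hx hfin1 n⟩, ?_, ?_⟩
  · obtain ⟨g, hg⟩ := exists_eventuallyEq_hpoly hc1
    refine ⟨fun j => g j, (isHilbertCoeffs_iff fun _ => rfl).2 hg, fun g' hg' => funext fun i => ?_⟩
    -- Uniqueness: `hcoeff` expresses every coefficient through lengths that do not involve g.
    obtain ⟨h1, h2⟩ := hcoeff _ hg'
    obtain ⟨h3, h4⟩ := hcoeff _ ((isHilbertCoeffs_iff fun _ => rfl).2 hg)
    rcases Nat.eq_zero_or_pos (i : ℕ) with hi | hi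
    · obtain rfl : i = 0 := Fin.ext hi
      rw [h1, h3]
    · exact sub_left_injective ((h2 i hi).unique (h4 i hi))
  · intro g hg
    obtain ⟨h1, h2⟩ := hcoeff g hg
    refine ⟨?_, fun i hi =>
      -- Both sums have the same value because their summands agree term by term, by `hfirst` and
      -- `hsecond`.
      ⟨g i - (-1) ^ d * (if (i : ℕ) = d then (len R (R ⧸ filt I₁ I₂ 0) : ℤ) else 0),
        g i - (-1) ^ d * (if (i : ℕ) = d then (len R (R ⧸ filt I₁ I₂ 0) : ℤ) else 0),
        ?_, ?_, ?_, ?_⟩⟩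
    · rw [h1]
      exact_mod_cast hmult
    · simpa only [hfirst] using h2 i hi
    · simpa only [hsecond] using h2 i hi
    all_goals
      rcases eq_or_ne (i : ℕ) d with h | h
      · rw [if_pos h, if_pos h, show filt I₁ I₂ 0 = I₁ by simp [filt]]
        ring
      · rw [if_neg h, if_neg h, len_subsingleton (M := R ⧸ (⊤ : Ideal R))]
        simp
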